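/- **Setting.** Fix finite sets $\mathrm{Var}$ and $\mathrm{Val}$. Let $\mathsf{Act}=\{(v\leftarrow n),(v\leftarrow v') : v,v'\in\mathrm{Var},\ n\in\mathrm{Val}\}$ and let $\mathsf{State}$ be the set of partial functions $\alpha:\mathrm{Var}\rightharpoonup\mathrm{Val}$, with domain $\mathrm{dom}(\alpha)$. A pomset over an alphabet $\Sigma$ is an isomorphism class $U=[\mathbf u]$ of finite labelled posets $\mathbf u=\langle S,\le,\lambda\rangle$, $\lambda:S\to\Sigma$. $U\parallel V$ is represented by the disjoint union of representatives; $U\cdot V$ is represented by the disjoint union in which moreover every node of $U$ is below every node of $V$; $1$ is the empty pomset, and a letter denotes the one-node pomset with that label. The series-parallel pomsets $\mathsf{SP}(\Sigma)$ are the smallest set containing $1$ and all letters and closed under $\cdot$ and $\parallel$. *Operations on states.* $\alpha[v\leftarrow n]$ always exists and $\alpha[v\leftarrow v']$ exists iff $v'\in\mathrm{dom}(\alpha)$; it agrees with $\alpha$ on all variables other than $v$, and maps $v$ to $n$, resp. to $\alpha(v')$. The state $\alpha\oplus\beta=\alpha\cup\beta$ is defined iff $\alpha(v)=\beta(v)$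 for all $v\in\mathrm{dom}(\alpha)\cap\mathrm{dom}(\beta)$. *Guarded pomsets.* $\mathcal G$ is the smallest set of pomsets over $\mathsf{Act}\cup\mathsf{State}$ such that, for all $\alpha,\beta,\gamma,\delta\in\mathsf{State}$, $a\in\mathsf{Act}$ and pomsets $U,V$: - $\alpha\in\mathcal G$; - if $\alpha[a]$ exists, then $\alpha\cdot a\cdot\alpha[a]\in\mathcal G$; - if $U\cdot\alpha\in\mathcal G$ and $\alpha\cdot V\in\mathcal G$, then $U\cdot\alpha\cdot V\in\mathcal G$; - if $\alpha\cdot U\cdot\beta\in\mathcal G$, $\gamma\cdot V\cdot\delta\in\mathcal G$, and $\alpha\oplus\gamma$, $\beta\oplus\delta$ are defined, then $(\alpha\oplus\gamma)\cdot(U\parallel V)\cdot(\beta\oplus\delta)\in\mathcal G$. *Nodes and paths.* Let $U=[\mathbf u]$ be a pomset over $\mathsf{Act}\cup\mathsf{State}$, $\mathbf u=\langle S,\le,\lambda\rangle$. A node is a state-node if its label is in $\mathsf{State}$ and an action-node otherwise. A node $p$ is the predecessor of $x$ if $p<x$ and every $y<x$ satisfies $y\le p$; the successor is defined dually. For state-nodes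 $x\le y$ and $v\in\mathrm{dom}(\lambda(x))$, a path for $v$ from $x$ to $y$ is a sequence $q_1,a_1,q_2,\dots,a_n,q_{n+1}$ of nodes ($n\ge 0$) such that the $q_i$ are state-nodes, the $a_i$ are action-nodes with $x\le a_i\le y$ and $a_i\le a_{i+1}$, $q_1=x$, $q_{n+1}=y$, the predecessor of $a_i$ is $q_i$ and its successor is $q_{i+1}$, and for $1\le i\le n$ $$\lambda(q_{i+1})(v)=\begin{cases} m & \text{if }\lambda(a_i)=(v\leftarrow m)\text{ for some }m\in\mathrm{Val},\\ \lambda(q_i)(v') & \text{if }\lambda(a_i)=(v\leftarrow v')\text{ for some }v'\in\mathrm{dom}(\lambda(q_i)),\\ \lambda(q_i)(v) & \text{otherwise.}\end{cases}$$ **Theorem.** Let $U=[\mathbf u]\in\mathsf{SP}(\mathsf{Act}\cup\mathsf{State})$. Then $U\in\mathcal G$ if and only if all of the following hold: - (A1) $\mathbf u$ has a unique minimum $*_{\min}$ and a unique maximum $*_{\max}$ (least and greatest node), and both are state-nodes. - (A2) Whenever $x<y$ are state-nodes, there is an action-node $z$ with $x<z<y$. - (A3) Every action-node has a predecessor and a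 successor, which are (unique) state-nodes. - (A4) For every state-node $x$ and every $v\in\mathrm{dom}(\lambda(x))$ there is a path for $v$ from $x$ to $*_{\max}$. - (A5) If $\lambda(x)=(v\leftarrow n)$ with $n\in\mathrm{Val}$, then the successor $s$ of $x$ satisfies $\lambda(s)(v)=n$. - (A6) If $\lambda(x)=(v\leftarrow v')$ with $v'\in\mathrm{Var}$, and $p$, $s$ are the predecessor and the successor of $x$, then $v'\in\mathrm{dom}(\lambda(p))$ and $\lambda(s)(v)=\lambda(s)(v')=\lambda(p)(v')$. - (A7) For every state-node $x$ and every $v\in\mathrm{dom}(\lambda(x))$ there are a node $s$ and a path for $v$ from $s$ to $x$ such that either $s=*_{\min}$ and $v\in\mathrm{dom}(\lambda(s))$, or $s$ is the successor of a node labelled $v\leftarrow k$ for some $k\in\mathrm{Var}\cup\mathrm{Val}$. -/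

import Mathlib

/-! ### Labelled posets and pomsets -/

/-- A finite labelled poset over the alphabet `A`. (Up to isomorphism, every finite set is a
type in `Type`, so no pomset is lost by taking carriers there.) -/
structure LPoset (A : Type*) where
  /-- the set of nodes -/
  carrier : Type
  [order : PartialOrder carrier]
  [finite : Finite carrier]
  /-- the labelling of the nodes -/
  label : carrier → A

attribute [instance] LPoset.order LPoset.finite

namespace LPoset

variable {A : Type*}

/-- Isomorphism: a bijection that preserves labels, and preserves and reflects the order. -/
def Iso (u v : LPoset A) : Prop :=
  ∃ h : u.carrier ≃o v.carrier, ∀ x, v.label (h x) = u.label x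

theorem Iso.refl (u : LPoset A) : Iso u u := ⟨OrderIso.refl _, fun _ => rfl⟩

theorem Iso.symm {u v : LPoset A} : Iso u v → Iso v u := by
  rintro ⟨h, hl⟩
  refine ⟨h.symm, fun x => ?_⟩
  rw [← hl (h.symm x), OrderIso.apply_symm_apply]

theorem Iso.trans {u v w : LPoset A} : Iso u v → Iso v w → Iso u w := by
  rintro ⟨h, hl⟩ ⟨k, kl⟩
  exact ⟨h.trans k, fun x => by rw [OrderIso.trans_apply, kl, hl]⟩

instance setoid (A : Type*) : Setoid (LPoset A) where
  r := Iso
  iseqv := ⟨Iso.refl, Iso.symm, Iso.trans⟩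

/-- The labelled poset without nodes. -/
def empty (A : Type*) : LPoset A where
  carrier := Empty
  label := Empty.elim

/-- The labelled poset with a single node, labelled by `a`. -/
def single (a : A) : LPoset A where
  carrier := Unit
  label := fun _ => a

/-- Parallel composition: the disjoint union, where nodes of `u` and nodes of `v` are
unrelated. -/
def par (u v : LPoset A) : LPoset A where
  carrier := u.carrier ⊕ v.carrier
  label := Sum.elim u.label v.label

/-- Sequential composition: the disjoint union, where every node of `u` is below every node
of `v`. -/
def seq (u v : LPoset A) : LPoset A where
  carrier := u.carrier ⊕ₗ v.carrier
  finite := inferInstanceAs (Finite (u.carrier ⊕ v.carrier))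
  label := fun x => Sum.elim u.label v.label (ofLex x)

theorem par_congr {u u' v v' : LPoset A} (hu : Iso u u') (hv : Iso v v') :
    Iso (par u v) (par u' v') := by
  obtain ⟨h, hl⟩ := hu
  obtain ⟨k, kl⟩ := hv
  refine ⟨OrderIso.sumCongr h k, ?_⟩
  rintro (x | x)
  · exact hl x
  · exact kl x

theorem seq_congr {u u' v v' : LPoset A} (hu : Iso u u') (hv : Iso v v') :
    Iso (seq u v) (seq u' v') := by
  obtain ⟨h, hl⟩ := hu
  obtain ⟨k, kl⟩ := hv
  refine ⟨OrderIso.sumLexCongr h k, fun x => ?_⟩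
  rcases x with x | x
  · exact hl x
  · exact kl x

end LPoset

/-- A pomset over `A`: an isomorphism class of finite labelled posets over `A`. -/
def Pomset (A : Type*) : Type _ := Quotient (LPoset.setoid A)

namespace Pomset

variable {A : Type*}

/-- The pomset represented by a labelled poset. -/
def mk (u : LPoset A) : Pomset A := Quotient.mk _ u

/-- The empty pomset, written `1` in the literature. -/
def one (A : Type*) : Pomset A := mk (LPoset.empty A)

/-- The pomset with a single node, labelled by `a`. -/
def atom (a : A) : Pomset A := mk (LPoset.single a)

/-- Parallel composition of pomsets. -/
def par (U V : Pomset A) : Pomset A :=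
  Quotient.map₂ LPoset.par (fun _ _ hu _ _ hv => LPoset.par_congr hu hv) U V

/-- Sequential composition of pomsets. -/
def seq (U V : Pomset A) : Pomset A :=
  Quotient.map₂ LPoset.seq (fun _ _ hu _ _ hv => LPoset.seq_congr hu hv) U V

/-- The series-parallel pomsets. -/
inductive IsSP : Pomset A → Prop
  | one : IsSP (one A)
  | atom (a : A) : IsSP (atom a)
  | par {U V : Pomset A} : IsSP U → IsSP V → IsSP (par U V)
  | seq {U V : Pomset A} : IsSP U → IsSP V → IsSP (seq U V)

end Pomset

/-! ### Actions, states, guarded pomsets -/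

/-- Actions: assignments of a value or of a variable to a variable. -/
inductive Act (Var Val : Type*)
  /-- `assign v n` is `v ← n` -/
  | assign (v : Var) (n : Val)
  /-- `copy v v'` is `v ← v'` -/
  | copy (v v' : Var)

/-- States: partial functions from variables to values; `none` means undefined. -/
abbrev State (Var Val : Type*) := Var → Option Val

/-- The alphabet `Act ∪ State`. -/
abbrev Letter (Var Val : Type*) := Act Var Val ⊕ State Var Val

namespace State

variable {Var Val : Type*}

/-- The domain of a state. -/
def dom (α : State Var Val) : Set Var := {v | (α v).isSome}

/-- `α[a]` exists. -/
def UpdateExists (α : State Var Val) : Act Var Val → Prop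
  | .assign _ _ => True
  | .copy _ v' => v' ∈ dom α

open Classical in
/-- The updated state `α[a]` (meaningful when `UpdateExists α a`). -/
noncomputable def update (α : State Var Val) : Act Var Val → State Var Val
  | .assign v n => fun w => if w = v then some n else α w
  | .copy v v' => fun w => if w = v then α v' else α w

/-- `α ⊕ β` is defined: the two states agree wherever both are defined. -/
def Compatible (α β : State Var Val) : Prop := ∀ v ∈ dom α ∩ dom β, α v = β v

/-- The union `α ∪ β`, which is `α ⊕ β` when the states are compatible. -/
def join (α β : State Var Val) : State Var Val := fun v => (α v).or (β v)

open Classical in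
/-- The value that `v` should have right after the action `a` was executed in state `α`;
a copy from a variable that is undefined in `α` leaves `v` unchanged. -/
noncomputable def nextValue (α : State Var Val) (v : Var) : Act Var Val → Option Val
  | .assign w n => if w = v then some n else α v
  | .copy w v' => if w = v ∧ v' ∈ dom α then α v' else α v

end State

namespace Pomset

variable {Var Val : Type*}

/-- The one-node pomset labelled by a state. -/
def ofState (α : State Var Val) : Pomset (Letter Var Val) := atom (Sum.inr α)

/-- The one-node pomset labelled by an action. -/
def ofAct (a : Act Var Val) : Pomset (Letter Var Val) := atom (Sum.inl a)

/-- The guarded pomsets. -/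
inductive IsGuarded : Pomset (Letter Var Val) → Prop
  | state (α : State Var Val) : IsGuarded (ofState α)
  | act (α : State Var Val) (a : Act Var Val) (h : α.UpdateExists a) :
      IsGuarded (((ofState α).seq (ofAct a)).seq (ofState (α.update a)))
  | seq (U V : Pomset (Letter Var Val)) (α : State Var Val)
      (hU : IsGuarded (U.seq (ofState α))) (hV : IsGuarded ((ofState α).seq V)) :
      IsGuarded ((U.seq (ofState α)).seq V)
  | par (U V : Pomset (Letter Var Val)) (α β γ δ : State Var Val)
      (hU : IsGuarded (((ofState α).seq U).seq (ofState β)))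
      (hV : IsGuarded (((ofState γ).seq V).seq (ofState δ)))
      (hmin : α.Compatible γ) (hmax : β.Compatible δ) :
      IsGuarded (((ofState (α.join γ)).seq (U.par V)).seq (ofState (β.join δ)))

end Pomset

/-! ### The seven properties -/

namespace LPoset

variable {Var Val : Type*} (u : LPoset (Letter Var Val))

/-- `x` is a state-node. -/
def IsStateNode (x : u.carrier) : Prop := ∃ α, u.label x = Sum.inr α

/-- `x` is an action-node. -/
def IsActNode (x : u.carrier) : Prop := ∃ a, u.label x = Sum.inl a

/-- The state that labels `x` (the nowhere defined state if `x` is an action-node). -/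
def stateAt (x : u.carrier) : State Var Val := Sum.elim (fun _ _ => none) id (u.label x)

/-- `p` is the predecessor of `x`: the latest node strictly before `x`. -/
def IsPredecessor (p x : u.carrier) : Prop := p < x ∧ ∀ y, y < x → y ≤ p

/-- `s` is the successor of `x`: the earliest node strictly after `x`. -/
def IsSuccessor (s x : u.carrier) : Prop := x < s ∧ ∀ y, x < y → s ≤ y

/-- The state-nodes `q 0, …, q n` and the action-nodes `a 0, …, a (n - 1)` form a path
`q 0, a 0, q 1, …, a (n - 1), q n` for the variable `v` from `x` to `y`. -/
structure IsPath (v : Var) (x y : u.carrier) {n : ℕ} (q : Fin (n + 1) → u.carrier)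
    (a : Fin n → u.carrier) : Prop where
  le : x ≤ y
  start_state : u.IsStateNode x
  end_state : u.IsStateNode y
  act_node : ∀ i, u.IsActNode (a i)
  act_between : ∀ i, x ≤ a i ∧ a i ≤ y
  act_chain : ∀ i j : Fin n, (i : ℕ) + 1 = j → a i ≤ a j
  state_node : ∀ i, u.IsStateNode (q i)
  pred : ∀ i : Fin n, u.IsPredecessor (q i.castSucc) (a i)
  succ : ∀ i : Fin n, u.IsSuccessor (q i.succ) (a i)
  first : q 0 = x
  mem_dom : v ∈ (u.stateAt x).dom
  last : q (Fin.last n) = y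
  step : ∀ (i : Fin n) (b : Act Var Val), u.label (a i) = Sum.inl b →
    u.stateAt (q i.succ) v = (u.stateAt (q i.castSucc)).nextValue v b

/-- There is a path for `v` from `x` to `y`. -/
def HasPath (v : Var) (x y : u.carrier) : Prop :=
  ∃ (n : ℕ) (q : Fin (n + 1) → u.carrier) (a : Fin n → u.carrier), u.IsPath v x y q a

/-- `x` is labelled by an assignment `v ← k` to `v`, with `k` a value or a variable. -/
def AssignsTo (x : u.carrier) (v : Var) : Prop :=
  (∃ n : Val, u.label x = Sum.inl (Act.assign v n)) ∨
    ∃ v' : Var, u.label x = Sum.inl (Act.copy v v')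

/-- There are a unique minimum (least node) and a unique maximum (greatest node), and they are
labelled by states. -/
def A1 : Prop :=
  (∃! m, IsBot m ∧ u.IsStateNode m) ∧ ∃! m, IsTop m ∧ u.IsStateNode m

/-- Every two related state-nodes are separated by an action-node. -/
def A2 : Prop :=
  ∀ x y, u.IsStateNode x → u.IsStateNode y → x < y → ∃ z, u.IsActNode z ∧ x < z ∧ z < y

/-- Action-nodes have unique state-nodes as neighbours. -/
def A3 : Prop :=
  ∀ x, u.IsActNode x →
    (∃! p, u.IsPredecessor p x ∧ u.IsStateNode p) ∧ ∃! s, u.IsSuccessor s x ∧ u.IsStateNode s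

/-- From every state-node there is a path to the maximum, for each variable in its domain. -/
def A4 : Prop :=
  ∀ x, u.IsStateNode x → ∀ v ∈ (u.stateAt x).dom, ∃ m, IsTop m ∧ u.HasPath v x m

/-- The effect of `v ← n` is recorded in the successor. -/
def A5 : Prop :=
  ∀ x v n, u.label x = Sum.inl (Act.assign v n) →
    ∃ s, u.IsSuccessor s x ∧ u.stateAt s v = some n

/-- The effect of `v ← v'` is recorded in the successor, and the predecessor knows `v'`. -/
def A6 : Prop :=
  ∀ x v v', u.label x = Sum.inl (Act.copy v v') →
    ∃ p s, u.IsPredecessor p x ∧ u.IsSuccessor s x ∧ v' ∈ (u.stateAt p).dom ∧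
      u.stateAt s v = u.stateAt s v' ∧ u.stateAt s v' = u.stateAt p v'

/-- Each variable in the domain of a state-node has a path to that node, from the minimum or
from the successor of an assignment to that variable. -/
def A7 : Prop :=
  ∀ x, u.IsStateNode x → ∀ v ∈ (u.stateAt x).dom, ∃ s, u.HasPath v s x ∧
    ((v ∈ (u.stateAt s).dom ∧ IsBot s) ∨ ∃ a, u.AssignsTo a v ∧ u.IsSuccessor s a)

end LPoset

/-! The properties say that every action reads and writes correctly in its two neighbouring states,
and that every variable known at a state-node has a history (a path from the minimum or from an
assignment) and a future (a path to the maximum). `LPoset.Good` packages this, with a path turned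
into the reflexive transitive closure of single steps (`LPoset.hasPath_iff`) and with sources and
sinks relative to a set of nodes, so that they can be moved between a poset and its parts.

Two transfer principles carry the proof. Upwards, `LPoset.Good.of_arms`: a poset covered by good
parts is good once each part's extremal nodes are linked to the outside. Downwards,
`LPoset.Good.pullback`: a part of a good poset is good when its states keep exactly the variables
that have a source and a sink inside the part.

Guarded implies good by induction on the construction: sequential and parallel composition are two
ways of covering by parts (`LPoset.Good.seq`, `LPoset.Good.par`), and a single action is computed
directly (`LPoset.good_bracket_single_iff`).

Conversely, a good series-parallel pomset with more than one node has the form `σ · X · τ` with `X`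
series-parallel, and one inducts on the size of `X`. A2 forces an action into `X`, so `X` is not
empty and not a lone state; a lone action forces `τ` to be the update of `σ`. If `X = P ∥ Q`, each
variable of `σ` is sent to a side containing the first action on its path, each variable of `τ` to a
side containing the last action on its path or the assignment creating it; this writes `σ` and `τ`
as joins (`LPoset.Good.exists_of_par`). If `X = P · Q`, A2 and A3 force a state-node at the border
(`LPoset.Good.exists_isTop_or_isBot`), and the pomset can be cut there (`Pomset.Good.seq_iff`). -/

open Relation

/-! ### States and the effect of an action -/

namespace State

variable {Var Val : Type*}

theorem mem_dom_iff {α : State Var Val} {v : Var} : v ∈ α.dom ↔ ∃ n, α v = some n :=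
  Option.isSome_iff_exists

/-- The effect of the action `b` is recorded in the states `α` before and `β` after it. -/
def Records (α : State Var Val) (b : Act Var Val) (β : State Var Val) : Prop :=
  match b with
  | .assign v n => β v = some n
  | .copy v v' => ∃ n, α v' = some n ∧ β v = some n ∧ β v' = some n

/-- `α` is a restriction of `β`. -/
def Sub (α β : State Var Val) : Prop := ∀ v n, α v = some n → β v = some n

theorem Records.mono {α α' β β' : State Var Val} {b : Act Var Val} (h : Records α b β)
    (hα : Sub α α') (hβ : Sub β β') : Records α' b β' := by
  cases b with
  | assign v n => exact hβ _ _ h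
  | copy v v' =>
    obtain ⟨n, h1, h2, h3⟩ := h
    exact ⟨n, hα _ _ h1, hβ _ _ h2, hβ _ _ h3⟩

theorem nextValue_mem {α : State Var Val} {v : Var} (h : v ∈ α.dom) (b : Act Var Val) :
    ∃ n, α.nextValue v b = some n := by
  cases b with
  | assign w n =>
    by_cases hw : w = v
    · exact ⟨n, by simp [nextValue, hw]⟩
    · simpa [nextValue, hw] using mem_dom_iff.1 h
  | copy w v' =>
    by_cases hw : w = v ∧ v' ∈ α.dom
    · simpa only [nextValue, if_pos hw] using mem_dom_iff.1 hw.2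
    · simpa only [nextValue, if_neg hw] using mem_dom_iff.1 h

/-- If the action can read its arguments in `α`, the next value of `v` is the same in every
extension of `α`. -/
theorem nextValue_mono {α α' β : State Var Val} {b : Act Var Val} (hα : Sub α α')
    (hb : Records α b β) {v : Var} (hv : v ∈ α.dom) : α'.nextValue v b = α.nextValue v b := by
  obtain ⟨n, hn⟩ := mem_dom_iff.1 hv
  have hn' := hα _ _ hn
  cases b with
  | assign w m => simp [nextValue, hn, hn']
  | copy w v' =>
    -- `Records` is needed here: a copy source undefined in `α` but defined in `α'` would change `v`
    -- only in the extension.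
    obtain ⟨k, h1, -, -⟩ := hb
    have h1' := hα _ _ h1
    have e1 : v' ∈ α.dom := mem_dom_iff.2 ⟨k, h1⟩
    have e2 : v' ∈ α'.dom := mem_dom_iff.2 ⟨k, h1'⟩
    by_cases hw : w = v
    · simp only [nextValue, if_pos (And.intro hw e1), if_pos (And.intro hw e2), h1, h1']
    · simp [nextValue, hw, hn, hn']

/-- Holds also for `v = v'`. Hence the equation that A6 imposes on `v'` in the successor makes every
copy a step of a path for the variable it reads. -/
theorem nextValue_copy_self (α : State Var Val) (v v' : Var) :
    α.nextValue v' (.copy v v') = α v' := by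
  simp [nextValue]

end State

/-! ### Paths as sequences of single steps -/

namespace LPoset

variable {Var Val : Type*} {u w : LPoset (Letter Var Val)}

/-- `stateAt` is nowhere defined at action-nodes, so a variable in its domain certifies a
state-node. This lets `Good` quantify over all nodes in its source and sink clauses. -/
theorem isStateNode_of_stateAt {x : u.carrier} {v : Var} {n : Val}
    (h : u.stateAt x v = some n) : u.IsStateNode x := by
  unfold stateAt at h
  unfold IsStateNode
  cases hx : u.label x with
  | inl b => simp [hx] at h
  | inr α => exact ⟨α, rfl⟩

theorem isStateNode_of_mem_dom {x : u.carrier} {v : Var} (h : v ∈ (u.stateAt x).dom) :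
    u.IsStateNode x :=
  isStateNode_of_stateAt (State.mem_dom_iff.1 h).choose_spec

theorem isStateNode_or_isActNode (x : u.carrier) : u.IsStateNode x ∨ u.IsActNode x := by
  unfold IsStateNode IsActNode
  cases u.label x <;> simp

theorem IsStateNode.label_ne {x : u.carrier} (h : u.IsStateNode x) {b : Act Var Val} :
    u.label x ≠ Sum.inl b := by
  obtain ⟨α, h⟩ := h
  simp [h]

theorem IsPredecessor.unique {p p' x : u.carrier} (h : u.IsPredecessor p x)
    (h' : u.IsPredecessor p' x) : p = p' :=
  le_antisymm (h'.2 _ h.1) (h.2 _ h'.1)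

theorem IsSuccessor.unique {s s' x : u.carrier} (h : u.IsSuccessor s x)
    (h' : u.IsSuccessor s' x) : s = s' :=
  le_antisymm (h.2 _ h'.1) (h'.2 _ h.1)

/-- `x, a, y` is a path for `v` with a single action-node `a`, and lies in `S`. -/
def StepOn (S : Set u.carrier) (v : Var) (x y : u.carrier) : Prop :=
  ∃ a b, a ∈ S ∧ x ∈ S ∧ y ∈ S ∧ u.label a = Sum.inl b ∧ u.IsPredecessor x a ∧
    u.IsSuccessor y a ∧ u.stateAt y v = (u.stateAt x).nextValue v b

theorem StepOn.lt {S : Set u.carrier} {v : Var} {x y : u.carrier} (h : StepOn S v x y) :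
    x < y := by
  obtain ⟨a, b, -, -, -, -, h1, h2, -⟩ := h
  exact h1.1.trans h2.1

theorem StepOn.mem_dom {S : Set u.carrier} {v : Var} {x y : u.carrier} (h : StepOn S v x y)
    (hx : v ∈ (u.stateAt x).dom) : v ∈ (u.stateAt y).dom := by
  obtain ⟨a, b, -, -, -, -, -, -, h⟩ := h
  rw [State.mem_dom_iff, h]
  exact State.nextValue_mem hx b

theorem le_of_steps {S : Set u.carrier} {v : Var} {x y : u.carrier}
    (h : ReflTransGen (StepOn S v) x y) : x ≤ y := by
  induction h with
  | refl => exact le_rfl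
  | tail _ h ih => exact ih.trans h.lt.le

theorem mem_dom_of_steps {S : Set u.carrier} {v : Var} {x y : u.carrier}
    (h : ReflTransGen (StepOn S v) x y) (hx : v ∈ (u.stateAt x).dom) :
    v ∈ (u.stateAt y).dom := by
  induction h with
  | refl => exact hx
  | tail _ h ih => exact h.mem_dom ih

theorem IsPath.cons {v : Var} {x y z a : u.carrier} {b : Act Var Val} {n : ℕ}
    {q : Fin (n + 1) → u.carrier} {c : Fin n → u.carrier} (h : u.IsPath v y z q c)
    (hx : v ∈ (u.stateAt x).dom) (ha : u.label a = Sum.inl b) (hp : u.IsPredecessor x a)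
    (hs : u.IsSuccessor y a) (hv : u.stateAt y v = (u.stateAt x).nextValue v b) :
    u.IsPath v x z (Fin.cons x q : Fin (n + 2) → u.carrier)
      (Fin.cons a c : Fin (n + 1) → u.carrier) where
  le := (hp.1.trans hs.1).le.trans h.le
  start_state := isStateNode_of_mem_dom hx
  end_state := h.end_state
  act_node := Fin.cases ⟨b, ha⟩ h.act_node
  act_between := Fin.cases ⟨hp.1.le, hs.1.le.trans h.le⟩ fun i =>
    ⟨(hp.1.trans hs.1).le.trans (h.act_between i).1, (h.act_between i).2⟩
  act_chain := by
    intro i j hij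
    induction j using Fin.cases with
    | zero => simp at hij
    | succ j =>
      induction i using Fin.cases with
      | zero => exact hs.1.le.trans (h.act_between j).1
      | succ i => exact h.act_chain i j (by simpa using hij)
  state_node := Fin.cases (isStateNode_of_mem_dom hx) h.state_node
  pred := Fin.cases (by simpa using hp) fun i => by simpa using h.pred i
  succ := Fin.cases (by simpa [h.first] using hs) fun i => by simpa using h.succ i
  first := rfl
  mem_dom := hx
  last := h.last
  step := by
    intro i
    induction i using Fin.cases with
    | zero =>
      intro b' hb'
      obtain rfl : b = b' := by simpa [ha] using hb'
      simpa [h.first] using hv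
    | succ i =>
      intro b' hb'
      simpa using h.step i b' hb'

/-- The conditions on the order of the actions follow from the predecessor and successor conditions,
so only the local data of each step matters. The domain of `v` is needed only at the start, since a
step never loses a variable. -/
theorem hasPath_iff {v : Var} {x y : u.carrier} :
    u.HasPath v x y ↔
      v ∈ (u.stateAt x).dom ∧ ReflTransGen (StepOn Set.univ v) x y := by
  constructor
  · rintro ⟨n, q, a, h⟩
    refine ⟨h.mem_dom, ?_⟩
    have key : ∀ i, ReflTransGen (StepOn Set.univ v) x (q i) := by
      intro i
      induction i using Fin.induction with
      | zero => rw [h.first]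
      | succ i ih =>
        obtain ⟨b, hb⟩ := h.act_node i
        exact ih.tail ⟨a i, b, trivial, trivial, trivial, hb, h.pred i, h.succ i,
          h.step i b hb⟩
    rw [← h.last]
    exact key _
  · rintro ⟨hx, h⟩
    induction h using ReflTransGen.head_induction_on with
    | refl =>
      have hs := isStateNode_of_mem_dom hx
      exact ⟨0, fun _ => y, Fin.elim0, le_rfl, hs, hs, fun i => i.elim0, fun i => i.elim0,
        fun i => i.elim0, fun _ => hs, fun i => i.elim0, fun i => i.elim0, rfl, hx, rfl,
        fun i => i.elim0⟩
    | head hst _ ih =>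
      obtain ⟨n, q, c, h⟩ := ih (hst.mem_dom hx)
      obtain ⟨a, b, -, -, -, ha, hp, hs, hv⟩ := hst
      exact ⟨_, _, _, h.cons hx ha hp hs hv⟩

/-- Inside `S`, there is a path for `v` to `x` from the least node of `S` or from the successor
of an assignment to `v`. -/
def HasSource (S : Set u.carrier) (v : Var) (x : u.carrier) : Prop :=
  ∃ s ∈ S, v ∈ (u.stateAt s).dom ∧ ReflTransGen (StepOn S v) s x ∧
    ((∀ y ∈ S, s ≤ y) ∨ ∃ a ∈ S, u.AssignsTo a v ∧ u.IsSuccessor s a)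

/-- Inside `S`, there is a path for `v` from `x` to the greatest node of `S`. -/
def HasSink (S : Set u.carrier) (v : Var) (x : u.carrier) : Prop :=
  ∃ m ∈ S, (∀ y ∈ S, y ≤ m) ∧ ReflTransGen (StepOn S v) x m

theorem HasSource.tail {S : Set u.carrier} {v : Var} {x y : u.carrier} (h : HasSource S v x)
    (hxy : ReflTransGen (StepOn S v) x y) : HasSource S v y := by
  obtain ⟨s, hs, hv, hsx, h⟩ := h
  exact ⟨s, hs, hv, hsx.trans hxy, h⟩

theorem HasSink.head {S : Set u.carrier} {v : Var} {x y : u.carrier} (h : HasSink S v y)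
    (hxy : ReflTransGen (StepOn S v) x y) : HasSink S v x := by
  obtain ⟨m, hm, h, hym⟩ := h
  exact ⟨m, hm, h, hxy.trans hym⟩

/-- The seven properties, in a form that is convenient to work with. -/
structure Good (u : LPoset (Letter Var Val)) : Prop where
  bot : ∃ m, IsBot m ∧ u.IsStateNode m
  top : ∃ m, IsTop m ∧ u.IsStateNode m
  separated : u.A2
  act : ∀ a b, u.label a = Sum.inl b → ∃ p s, u.IsPredecessor p a ∧ u.IsSuccessor s a ∧
    u.IsStateNode p ∧ u.IsStateNode s ∧ (u.stateAt p).Records b (u.stateAt s)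
  sink : ∀ x v, v ∈ (u.stateAt x).dom → HasSink Set.univ v x
  source : ∀ x v, v ∈ (u.stateAt x).dom → HasSource Set.univ v x

theorem Good.records (h : u.Good) {a p s : u.carrier} {b : Act Var Val}
    (ha : u.label a = Sum.inl b) (hp : u.IsPredecessor p a) (hs : u.IsSuccessor s a) :
    (u.stateAt p).Records b (u.stateAt s) := by
  obtain ⟨p', s', hp', hs', -, -, h⟩ := h.act a b ha
  rwa [hp.unique hp', hs.unique hs']

/-- Predecessors and successors are unique, so the neighbours provided by A3 are those of A5 and A6,
and the three properties merge into the single clause `act`. -/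
theorem good_iff : u.Good ↔ u.A1 ∧ u.A2 ∧ u.A3 ∧ u.A4 ∧ u.A5 ∧ u.A6 ∧ u.A7 := by
  constructor
  · intro h
    refine ⟨⟨?_, ?_⟩, h.separated, ?_, ?_, ?_, ?_, ?_⟩
    · obtain ⟨m, hm⟩ := h.bot
      exact ⟨m, hm, fun y hy => le_antisymm (hy.1 _) (hm.1 _)⟩
    · obtain ⟨m, hm⟩ := h.top
      exact ⟨m, hm, fun y hy => le_antisymm (hm.1 _) (hy.1 _)⟩
    · rintro x ⟨b, hb⟩
      obtain ⟨p, s, hp, hs, hp', hs', -⟩ := h.act x b hb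
      exact ⟨⟨p, ⟨hp, hp'⟩, fun y hy => hy.1.unique hp⟩,
        ⟨s, ⟨hs, hs'⟩, fun y hy => hy.1.unique hs⟩⟩
    · intro x _ v hv
      obtain ⟨m, -, hm, hxm⟩ := h.sink x v hv
      exact ⟨m, fun y => hm y trivial, hasPath_iff.2 ⟨hv, hxm⟩⟩
    · intro x v n hx
      obtain ⟨p, s, -, hs, -, -, hr⟩ := h.act x _ hx
      exact ⟨s, hs, hr⟩
    · intro x v v' hx
      obtain ⟨p, s, hp, hs, -, -, n, h1, h2, h3⟩ := h.act x _ hx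
      exact ⟨p, s, hp, hs, State.mem_dom_iff.2 ⟨n, h1⟩, h2.trans h3.symm, h3.trans h1.symm⟩
    · intro x _ v hv
      obtain ⟨s, -, hs, hsx, h⟩ := h.source x v hv
      refine ⟨s, hasPath_iff.2 ⟨hs, hsx⟩, ?_⟩
      rcases h with h | ⟨a, -, h⟩
      · exact Or.inl ⟨hs, fun y => h y trivial⟩
      · exact Or.inr ⟨a, h⟩
  · rintro ⟨⟨⟨m, hm, -⟩, ⟨m', hm', -⟩⟩, h2, h3, h4, h5, h6, h7⟩
    refine ⟨⟨m, hm⟩, ⟨m', hm'⟩, h2, ?_, ?_, ?_⟩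
    · intro a b hb
      obtain ⟨⟨p, ⟨hp, hp'⟩, -⟩, ⟨s, ⟨hs, hs'⟩, -⟩⟩ := h3 a ⟨b, hb⟩
      refine ⟨p, s, hp, hs, hp', hs', ?_⟩
      cases b with
      | assign v n =>
        obtain ⟨s1, hs1, h⟩ := h5 a v n hb
        rwa [hs.unique hs1]
      | copy v v' =>
        obtain ⟨p1, s1, hp1, hs1, h, e1, e2⟩ := h6 a v v' hb
        rw [hs.unique hs1, hp.unique hp1]
        obtain ⟨n, hn⟩ := State.mem_dom_iff.1 h
        exact ⟨n, hn, e1.trans (e2.trans hn), e2.trans hn⟩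
    · intro x v hv
      obtain ⟨m, hm, hp⟩ := h4 x (isStateNode_of_mem_dom hv) v hv
      exact ⟨m, trivial, fun y _ => hm y, (hasPath_iff.1 hp).2⟩
    · intro x v hv
      obtain ⟨s, hp, h⟩ := h7 x (isStateNode_of_mem_dom hv) v hv
      refine ⟨s, trivial, (hasPath_iff.1 hp).1, (hasPath_iff.1 hp).2, ?_⟩
      rcases h with h | ⟨a, h⟩
      · exact Or.inl fun y _ => h.2 y
      · exact Or.inr ⟨a, trivial, h⟩

end LPoset

/-! ### Transfer between a poset and its parts -/

namespace LPoset

variable {Var Val : Type*} {u w : LPoset (Letter Var Val)}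

/-- An order embedding that preserves the action-nodes with their labels, and with their
neighbours. -/
structure IsArm (f : w.carrier → u.carrier) : Prop where
  le_iff : ∀ {x y}, f x ≤ f y ↔ x ≤ y
  label_act : ∀ {x b}, u.label (f x) = Sum.inl b ↔ w.label x = Sum.inl b
  below : ∀ {a b}, w.label a = Sum.inl b → ∀ y < f a, ∃ x < a, y ≤ f x
  above : ∀ {a b}, w.label a = Sum.inl b → ∀ y, f a < y → ∃ x, a < x ∧ f x ≤ y

namespace IsArm

variable {f : w.carrier → u.carrier} (hf : IsArm f)
include hf

theorem lt_iff {x y : w.carrier} : f x < f y ↔ x < y := by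
  simp only [lt_iff_le_not_ge, hf.le_iff]

theorem injective : Function.Injective f := fun _ _ h =>
  le_antisymm (hf.le_iff.1 h.le) (hf.le_iff.1 h.ge)

theorem isActNode {x : w.carrier} : u.IsActNode (f x) ↔ w.IsActNode x :=
  exists_congr fun _ => hf.label_act

theorem isStateNode {x : w.carrier} : u.IsStateNode (f x) ↔ w.IsStateNode x := by
  constructor
  · intro h
    rcases w.isStateNode_or_isActNode x with h' | ⟨b, h'⟩
    · exact h'
    · exact absurd (hf.label_act.2 h') h.label_ne
  · intro h
    rcases u.isStateNode_or_isActNode (f x) with h' | ⟨b, h'⟩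
    · exact h'
    · exact absurd (hf.label_act.1 h') h.label_ne

theorem assignsTo {x : w.carrier} {v : Var} : u.AssignsTo (f x) v ↔ w.AssignsTo x v := by
  simp only [AssignsTo, hf.label_act]

/-- The clause `below` makes the images of the nodes below `a` cofinal among all nodes below `f a`,
so nodes outside the part cannot come between. -/
theorem isPredecessor {a p : w.carrier} {b : Act Var Val} (ha : w.label a = Sum.inl b) :
    u.IsPredecessor (f p) (f a) ↔ w.IsPredecessor p a := by
  constructor
  · rintro ⟨h1, h2⟩
    exact ⟨hf.lt_iff.1 h1, fun y hy => hf.le_iff.1 (h2 _ (hf.lt_iff.2 hy))⟩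
  · rintro ⟨h1, h2⟩
    refine ⟨hf.lt_iff.2 h1, fun y hy => ?_⟩
    obtain ⟨x, hx, hyx⟩ := hf.below ha y hy
    exact hyx.trans (hf.le_iff.2 (h2 x hx))

theorem isSuccessor {a s : w.carrier} {b : Act Var Val} (ha : w.label a = Sum.inl b) :
    u.IsSuccessor (f s) (f a) ↔ w.IsSuccessor s a := by
  constructor
  · rintro ⟨h1, h2⟩
    exact ⟨hf.lt_iff.1 h1, fun y hy => hf.le_iff.1 (h2 _ (hf.lt_iff.2 hy))⟩
  · rintro ⟨h1, h2⟩
    refine ⟨hf.lt_iff.2 h1, fun y hy => ?_⟩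
    obtain ⟨x, hx, hxy⟩ := hf.above ha y hy
    exact (hf.le_iff.2 (h2 x hx)).trans hxy

theorem exists_predecessor {a : w.carrier} {p : u.carrier} {b : Act Var Val}
    (ha : w.label a = Sum.inl b) (hp : u.IsPredecessor p (f a)) :
    ∃ p', f p' = p ∧ w.IsPredecessor p' a := by
  obtain ⟨x, hx, hpx⟩ := hf.below ha p hp.1
  have h : f x = p := le_antisymm (hp.2 _ (hf.lt_iff.2 hx)) hpx
  exact ⟨x, h, (hf.isPredecessor ha).1 (h ▸ hp)⟩

theorem exists_successor {a : w.carrier} {s : u.carrier} {b : Act Var Val}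
    (ha : w.label a = Sum.inl b) (hs : u.IsSuccessor s (f a)) :
    ∃ s', f s' = s ∧ w.IsSuccessor s' a := by
  obtain ⟨x, hx, hsx⟩ := hf.above ha s hs.1
  have h : f x = s := le_antisymm hsx (hs.2 _ (hf.lt_iff.2 hx))
  exact ⟨x, h, (hf.isSuccessor ha).1 (h ▸ hs)⟩

end IsArm

/-- A part of `u` that is good itself, and whose states are restrictions of those of `u`. -/
structure GoodArm (f : w.carrier → u.carrier) : Prop where
  isArm : IsArm f
  good : w.Good
  sub : ∀ x, (w.stateAt x).Sub (u.stateAt (f x))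

/-- A good part of `u`, whose extremal nodes are connected for each variable with the
extremal nodes or with assignments of `u`. -/
structure AnchoredArm (f : w.carrier → u.carrier) : Prop extends GoodArm f where
  top_sink : ∀ m v, IsTop m → v ∈ (w.stateAt m).dom → HasSink Set.univ v (f m)
  bot_source : ∀ m v, IsBot m → v ∈ (w.stateAt m).dom → HasSource Set.univ v (f m)

namespace GoodArm

variable {f : w.carrier → u.carrier} (hf : GoodArm f)
include hf

/-- The larger state at `f x` could only change the next value of `v` by making a copy effective
that was void before; goodness of the part excludes void copies. -/
theorem step {v : Var} {x y : w.carrier} (h : StepOn Set.univ v x y)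
    (hx : v ∈ (w.stateAt x).dom) : StepOn Set.univ v (f x) (f y) := by
  have hy := h.mem_dom hx
  obtain ⟨a, b, -, -, -, ha, hp, hs, hv⟩ := h
  refine ⟨f a, b, trivial, trivial, trivial, hf.isArm.label_act.2 ha,
    (hf.isArm.isPredecessor ha).2 hp, (hf.isArm.isSuccessor ha).2 hs, ?_⟩
  obtain ⟨n, hn⟩ := State.mem_dom_iff.1 hy
  rw [State.nextValue_mono (hf.sub x) (hf.good.records ha hp hs) hx, ← hv, hn,
    hf.sub y v n hn]

theorem steps {v : Var} {x y : w.carrier} (h : ReflTransGen (StepOn Set.univ v) x y)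
    (hx : v ∈ (w.stateAt x).dom) : ReflTransGen (StepOn Set.univ v) (f x) (f y) := by
  induction h with
  | refl => exact .refl
  | tail h1 h2 ih => exact ih.tail (hf.step h2 (mem_dom_of_steps h1 hx))

theorem sub_dom {v : Var} {x : w.carrier} (hx : v ∈ (w.stateAt x).dom) :
    v ∈ (u.stateAt (f x)).dom := by
  obtain ⟨n, hn⟩ := State.mem_dom_iff.1 hx
  exact State.mem_dom_iff.2 ⟨n, hf.sub x v n hn⟩

end GoodArm

namespace AnchoredArm

variable {f : w.carrier → u.carrier} (hf : AnchoredArm f)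
include hf

theorem hasSink {v : Var} {x : w.carrier} (hx : v ∈ (w.stateAt x).dom) :
    HasSink Set.univ v (f x) := by
  obtain ⟨m, -, hm, h⟩ := hf.good.sink x v hx
  exact (hf.top_sink m v (fun y => hm y trivial) (mem_dom_of_steps h hx)).head (hf.toGoodArm.steps h hx)

/-- A source that is an assignment stays one in `u`, since the part keeps neighbours of actions; a
source that is the least node of the part is continued by the anchor. -/
theorem hasSource {v : Var} {x : w.carrier} (hx : v ∈ (w.stateAt x).dom) :
    HasSource Set.univ v (f x) := by
  obtain ⟨s, -, hv, hs, h⟩ := hf.good.source x v hx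
  rcases h with h | ⟨a, -, ha, hsa⟩
  · exact (hf.bot_source s v (fun y => h y trivial) hv).tail (hf.toGoodArm.steps hs hv)
  · refine ⟨f s, trivial, hf.toGoodArm.sub_dom hv, hf.toGoodArm.steps hs hv, Or.inr ⟨f a, trivial,
      hf.isArm.assignsTo.2 ha, ?_⟩⟩
    rcases ha with ⟨n, ha⟩ | ⟨v', ha⟩
    · exact (hf.isArm.isSuccessor ha).2 hsa
    · exact (hf.isArm.isSuccessor ha).2 hsa

end AnchoredArm

/-- The cover is required value by value: different variables of one state-node may come from
different parts, as happens at the joined end states of a parallel composition. A2 is not local to a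
part and stays a hypothesis. -/
theorem Good.of_arms (bot : ∃ m, IsBot m ∧ u.IsStateNode m)
    (top : ∃ m, IsTop m ∧ u.IsStateNode m) (sep : u.A2)
    (act : ∀ a b, u.label a = Sum.inl b →
      ∃ (w : LPoset (Letter Var Val)) (f : w.carrier → u.carrier), AnchoredArm f ∧ a ∈ Set.range f)
    (state : ∀ x v n, u.stateAt x v = some n →
      ∃ (w : LPoset (Letter Var Val)) (f : w.carrier → u.carrier) (y : w.carrier),
        AnchoredArm f ∧ f y = x ∧ w.stateAt y v = some n) : u.Good where
  bot := bot
  top := top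
  separated := sep
  act := by
    intro a b hab
    obtain ⟨w, f, hf, a, rfl⟩ := act a b hab
    have ha := hf.isArm.label_act.1 hab
    obtain ⟨p, s, hp, hs, hp', hs', h⟩ := hf.good.act a b ha
    exact ⟨f p, f s, (hf.isArm.isPredecessor ha).2 hp, (hf.isArm.isSuccessor ha).2 hs,
      hf.isArm.isStateNode.2 hp', hf.isArm.isStateNode.2 hs', h.mono (hf.sub p) (hf.sub s)⟩
  sink := by
    intro x v hv
    obtain ⟨n, hn⟩ := State.mem_dom_iff.1 hv
    obtain ⟨w, f, y, hf, rfl, hy⟩ := state x v n hn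
    exact hf.hasSink (State.mem_dom_iff.2 ⟨n, hy⟩)
  source := by
    intro x v hv
    obtain ⟨n, hn⟩ := State.mem_dom_iff.1 hv
    obtain ⟨w, f, y, hf, rfl, hy⟩ := state x v n hn
    exact hf.hasSource (State.mem_dom_iff.2 ⟨n, hy⟩)

theorem Good.of_iso (h : Iso w u) (hw : w.Good) : u.Good := by
  obtain ⟨e, he⟩ := h
  have hstate : ∀ x, u.stateAt (e x) = w.stateAt x := fun x => by simp [stateAt, he]
  have harm : IsArm (u := u) (w := w) e :=
    { le_iff := e.le_iff_le
      label_act := by simp [he]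
      below := fun {a b} _ y hy => ⟨e.symm y, by simpa [e.symm_apply_lt] using hy, by simp⟩
      above := fun {a b} _ y hy => ⟨e.symm y, by simpa [e.lt_symm_apply] using hy, by simp⟩ }
  have hbot : ∀ m, IsBot m → IsBot (e m) := fun m hm y => e.symm.le_iff_le.1 (by simpa using hm _)
  have htop : ∀ m, IsTop m → IsTop (e m) := fun m hm y => e.symm.le_iff_le.1 (by simpa using hm _)
  have hf : AnchoredArm (u := u) (w := w) e :=
    { isArm := harm
      good := hw
      sub := fun x v n hn => by rwa [hstate]
      top_sink := fun m v hm _ => ⟨e m, trivial, fun y _ => htop m hm y, .refl⟩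
      bot_source := fun m v hm hv => ⟨e m, trivial, by rwa [hstate], .refl,
        Or.inl fun y _ => hbot m hm y⟩ }
  refine .of_arms ?_ ?_ ?_ ?_ ?_
  · obtain ⟨m, hm, hm'⟩ := hw.bot
    exact ⟨e m, hbot m hm, harm.isStateNode.2 hm'⟩
  · obtain ⟨m, hm, hm'⟩ := hw.top
    exact ⟨e m, htop m hm, harm.isStateNode.2 hm'⟩
  · intro x y hx hy hxy
    obtain ⟨x, rfl⟩ := e.surjective x
    obtain ⟨y, rfl⟩ := e.surjective y
    obtain ⟨z, hz, hxz, hzy⟩ := hw.separated x y (harm.isStateNode.1 hx)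
      (harm.isStateNode.1 hy) (harm.lt_iff.1 hxy)
    exact ⟨e z, harm.isActNode.2 hz, harm.lt_iff.2 hxz, harm.lt_iff.2 hzy⟩
  · intro a b _
    exact ⟨w, e, hf, e.surjective a⟩
  · intro x v n hn
    obtain ⟨x, rfl⟩ := e.surjective x
    exact ⟨w, e, x, hf, rfl, by rwa [hstate] at hn⟩

/-- A part of a good poset is good, if each of its states is the restriction to the variables
that have a path from a source and a path to a sink inside the part. -/
theorem Good.pullback (hu : u.Good) {f : w.carrier → u.carrier} (hf : IsArm f)
    (bot : ∃ m, IsBot m ∧ w.IsStateNode m) (top : ∃ m, IsTop m ∧ w.IsStateNode m) (sep : w.A2)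
    (hstate : ∀ x v n, w.stateAt x v = some n ↔ u.stateAt (f x) v = some n ∧
      HasSource (Set.range f) v (f x) ∧ HasSink (Set.range f) v (f x))
    (hsource : ∀ x v, ¬ IsTop x → v ∈ (u.stateAt (f x)).dom → HasSource (Set.range f) v (f x))
    (hsink : ∀ x v, ¬ IsBot x → v ∈ (u.stateAt (f x)).dom → HasSink (Set.range f) v (f x)) :
    w.Good := by
  have hsub : ∀ x, (w.stateAt x).Sub (u.stateAt (f x)) := fun x v n h => ((hstate x v n).1 h).1
  have hdom : ∀ x v, v ∈ (w.stateAt x).dom ↔ v ∈ (u.stateAt (f x)).dom ∧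
      HasSource (Set.range f) v (f x) ∧ HasSink (Set.range f) v (f x) := by
    intro x v
    simp only [State.mem_dom_iff, hstate]
    exact exists_and_right
  have hact : ∀ a b, w.label a = Sum.inl b → ∃ p s, w.IsPredecessor p a ∧ w.IsSuccessor s a ∧
      w.IsStateNode p ∧ w.IsStateNode s ∧ (w.stateAt p).Records b (w.stateAt s) := by
    intro a b ha
    have ha' := hf.label_act.2 ha
    obtain ⟨p, s, hp', hs', hp1, hs1, hr⟩ := hu.act _ b ha'
    obtain ⟨p, rfl, hp⟩ := hf.exists_predecessor ha hp'
    obtain ⟨s, rfl, hs⟩ := hf.exists_successor ha hs'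
    refine ⟨p, s, hp, hs, hf.isStateNode.1 hp1, hf.isStateNode.1 hs1, ?_⟩
    -- Only the greatest node may lack sources and only the least node may lack sinks. An action
    -- lies between `p` and `s`, so `p` has its sources and `s` its sinks.
    have hpt : ¬ IsTop p := fun h => (h a).not_gt hp.1
    have hsb : ¬ IsBot s := fun h => (h a).not_gt hs.1
    have assigned : ∀ v n, u.AssignsTo (f a) v → u.stateAt (f s) v = some n →
        w.stateAt s v = some n := by
      intro v n hav hn
      have hv := State.mem_dom_iff.2 ⟨n, hn⟩
      -- An assigned variable is its own source at the successor of the assignment.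
      exact (hstate _ _ _).2 ⟨hn, ⟨f s, ⟨s, rfl⟩, hv, .refl, Or.inr ⟨f a, ⟨a, rfl⟩, hav, hs'⟩⟩,
        hsink s v hsb hv⟩
    cases b with
    | assign v n => exact assigned v n (Or.inl ⟨n, ha'⟩) hr
    | copy v v' =>
      obtain ⟨n, h1, h2, h3⟩ := hr
      -- The copied variable passes through the action unchanged; this step carries its source from
      -- `p` to `s` and its sink from `s` back to `p`.
      have hstep : StepOn (Set.range f) v' (f p) (f s) :=
        ⟨f a, _, ⟨a, rfl⟩, ⟨p, rfl⟩, ⟨s, rfl⟩, ha', hp', hs',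
          by rw [State.nextValue_copy_self, h1, h3]⟩
      have d1 := hsource p v' hpt (State.mem_dom_iff.2 ⟨n, h1⟩)
      have d2 := hsink s v' hsb (State.mem_dom_iff.2 ⟨n, h3⟩)
      exact ⟨n, (hstate _ _ _).2 ⟨h1, d1, d2.head (.single hstep)⟩,
        assigned v n (Or.inr ⟨v', ha'⟩) h2, (hstate _ _ _).2 ⟨h3, d1.tail (.single hstep), d2⟩⟩
  have hstep : ∀ x y v, StepOn (Set.range f) v (f x) (f y) → v ∈ (w.stateAt x).dom →
      HasSink (Set.range f) v (f y) → StepOn Set.univ v x y ∧ v ∈ (w.stateAt y).dom := by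
    intro x y v h hx hy
    have hy' : v ∈ (w.stateAt y).dom := (hdom y v).2
      ⟨h.mem_dom ((hdom x v).1 hx).1, ((hdom x v).1 hx).2.1.tail (.single h), hy⟩
    obtain ⟨a, b, ⟨a, rfl⟩, -, -, ha', hp', hs', hv⟩ := h
    have ha := hf.label_act.1 ha'
    have hp := (hf.isPredecessor ha).1 hp'
    have hs := (hf.isSuccessor ha).1 hs'
    refine ⟨⟨a, b, trivial, trivial, trivial, ha, hp, hs, ?_⟩, hy'⟩
    obtain ⟨p, s, hp1, hs1, -, -, hr⟩ := hact a b ha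
    rw [hp1.unique hp] at hr
    rw [← State.nextValue_mono (hsub x) hr hx, ← hv]
    obtain ⟨n, hn⟩ := State.mem_dom_iff.1 hy'
    rw [hn, hsub y v n hn]
  have hsteps : ∀ x y v, ReflTransGen (StepOn (Set.range f) v) (f x) (f y) →
      v ∈ (w.stateAt x).dom → HasSink (Set.range f) v (f y) →
      ReflTransGen (StepOn Set.univ v) x y := by
    intro x y v h hx hy
    generalize hx' : f x = x' at h
    induction h using ReflTransGen.head_induction_on generalizing x with
    | refl => rw [hf.injective hx']
    | head h1 h2 ih =>
      subst hx'
      have hc := h1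
      obtain ⟨-, -, -, -, ⟨c, rfl⟩, -⟩ := hc
      obtain ⟨h3, h4⟩ := hstep x c v h1 hx (hy.head h2)
      exact (ih c h4 rfl).head h3
  refine ⟨bot, top, sep, hact, ?_, ?_⟩
  · intro x v hv
    obtain ⟨hv', -, -, ⟨m, rfl⟩, hm, h⟩ := (hdom x v).1 hv
    exact ⟨m, trivial, fun y _ => hf.le_iff.1 (hm _ ⟨y, rfl⟩),
      hsteps x m v h hv ⟨_, ⟨m, rfl⟩, hm, .refl⟩⟩
  · intro x v hv
    obtain ⟨hv', ⟨-, ⟨s, rfl⟩, hs, hsx, h⟩, hx⟩ := (hdom x v).1 hv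
    -- The variable survives the restriction at `s`: there `s` is a source by itself, and the path
    -- through `x` leads to a sink.
    have hs' : v ∈ (w.stateAt s).dom := (hdom s v).2 ⟨hs, ⟨_, ⟨s, rfl⟩, hs, .refl, h⟩, hx.head hsx⟩
    refine ⟨s, trivial, hs', hsteps s x v hsx hs' hx, ?_⟩
    rcases h with h | ⟨-, ⟨a, rfl⟩, ha, hsa⟩
    · exact Or.inl fun y _ => hf.le_iff.1 (h _ ⟨y, rfl⟩)
    · refine Or.inr ⟨a, trivial, hf.assignsTo.1 ha, ?_⟩
      rcases hf.assignsTo.1 ha with ⟨n, ha⟩ | ⟨v', ha⟩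
      · exact (hf.isSuccessor ha).1 hsa
      · exact (hf.isSuccessor ha).1 hsa

end LPoset

/-! ### Order and algebra of sequential and parallel composition -/

namespace LPoset

section Seq

variable {A : Type*} {u v : LPoset A}

/-- The inclusion of `u` into `u · v`. -/
def seqL (v : LPoset A) (x : u.carrier) : (seq u v).carrier := Sum.inlₗ x

/-- The inclusion of `v` into `u · v`. -/
def seqR (u : LPoset A) (x : v.carrier) : (seq u v).carrier := Sum.inrₗ x

@[simp] theorem seqL_le_seqL {x y : u.carrier} : seqL v x ≤ seqL v y ↔ x ≤ y :=
  Sum.Lex.inl_le_inl_iff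

@[simp] theorem seqR_le_seqR {x y : v.carrier} : seqR u x ≤ seqR u y ↔ x ≤ y :=
  Sum.Lex.inr_le_inr_iff

@[simp] theorem seqL_lt_seqL {x y : u.carrier} : seqL v x < seqL v y ↔ x < y :=
  Sum.Lex.inl_lt_inl_iff

@[simp] theorem seqR_lt_seqR {x y : v.carrier} : seqR u x < seqR u y ↔ x < y :=
  Sum.Lex.inr_lt_inr_iff

@[simp] theorem seqL_le_seqR {x : u.carrier} {y : v.carrier} : seqL v x ≤ seqR u y :=
  Sum.Lex.inl_le_inr _ _

@[simp] theorem seqL_lt_seqR {x : u.carrier} {y : v.carrier} : seqL v x < seqR u y :=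
  Sum.Lex.inl_lt_inr _ _

@[simp] theorem not_seqR_le_seqL {x : u.carrier} {y : v.carrier} : ¬ seqR u y ≤ seqL v x :=
  Sum.Lex.not_inr_le_inl

@[simp] theorem not_seqR_lt_seqL {x : u.carrier} {y : v.carrier} : ¬ seqR u y < seqL v x :=
  Sum.Lex.not_inr_lt_inl

@[elab_as_elim]
theorem seq_ind {motive : (seq u v).carrier → Prop} (left : ∀ x, motive (seqL v x))
    (right : ∀ x, motive (seqR u x)) (z : (seq u v).carrier) : motive z := by
  rcases z with x | x
  · exact left x
  · exact right x

/-- The inclusion of `u` into `u ∥ v`. -/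
def parL (v : LPoset A) (x : u.carrier) : (par u v).carrier := Sum.inl x

/-- The inclusion of `v` into `u ∥ v`. -/
def parR (u : LPoset A) (x : v.carrier) : (par u v).carrier := Sum.inr x

@[simp] theorem parL_le_parL {x y : u.carrier} : parL v x ≤ parL v y ↔ x ≤ y :=
  Sum.inl_le_inl_iff

@[simp] theorem parR_le_parR {x y : v.carrier} : parR u x ≤ parR u y ↔ x ≤ y :=
  Sum.inr_le_inr_iff

@[simp] theorem not_parL_le_parR {x : u.carrier} {y : v.carrier} : ¬ parL v x ≤ parR u y :=
  Sum.not_inl_le_inr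

@[simp] theorem not_parR_le_parL {x : u.carrier} {y : v.carrier} : ¬ parR u y ≤ parL v x :=
  Sum.not_inr_le_inl

@[elab_as_elim]
theorem par_ind {motive : (par u v).carrier → Prop} (left : ∀ x, motive (parL v x))
    (right : ∀ x, motive (parR u x)) (z : (par u v).carrier) : motive z := by
  rcases z with x | x
  · exact left x
  · exact right x

end Seq

section Algebra

variable {A : Type*}

theorem seq_assoc_iso (u v w : LPoset A) : Iso (seq (seq u v) w) (seq u (seq v w)) := by
  refine ⟨OrderIso.sumLexAssoc _ _ _, ?_⟩
  intro x
  induction x using seq_ind with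
  | left x =>
    induction x using seq_ind with
    | left x => rfl
    | right x => rfl
  | right x => rfl

theorem seq_empty_iso (u : LPoset A) : Iso (seq u (empty A)) u :=
  have : IsEmpty (empty A).carrier := inferInstanceAs (IsEmpty Empty)
  ⟨OrderIso.sumLexEmpty, fun x => by
    induction x using seq_ind with
    | left x => rfl
    | right x => exact x.elim⟩

theorem empty_seq_iso (u : LPoset A) : Iso (seq (empty A) u) u :=
  have : IsEmpty (empty A).carrier := inferInstanceAs (IsEmpty Empty)
  ⟨OrderIso.emptySumLex, fun x => by
    induction x using seq_ind with
    | left x => exact x.elim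
    | right x => rfl⟩

theorem par_empty_iso (u : LPoset A) : Iso (par u (empty A)) u := by
  have : IsEmpty (empty A).carrier := inferInstanceAs (IsEmpty Empty)
  refine ⟨⟨Equiv.sumEmpty _ _, ?_⟩, ?_⟩
  · intro x y
    induction x using par_ind with
    | left x =>
      induction y using par_ind with
      | left y => exact parL_le_parL.symm
      | right y => exact y.elim
    | right x => exact x.elim
  · intro x
    induction x using par_ind with
    | left x => rfl
    | right x => exact x.elim

theorem par_comm_iso (u v : LPoset A) : Iso (par u v) (par v u) :=
  ⟨OrderIso.sumComm _ _, fun x => by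
    induction x using par_ind with
    | left x => rfl
    | right x => rfl⟩

theorem iso_empty (u : LPoset A) [IsEmpty u.carrier] : Iso u (empty A) :=
  have : IsEmpty (empty A).carrier := inferInstanceAs (IsEmpty Empty)
  ⟨⟨Equiv.equivOfIsEmpty _ _, fun {x} => isEmptyElim x⟩, fun x => isEmptyElim x⟩

end Algebra

end LPoset

/-! ### Algebra, size and decomposition of pomsets -/

namespace Pomset

open LPoset

variable {A : Type*}

theorem exists_mk (U : Pomset A) : ∃ u, U = mk u := ⟨U.out, (Quotient.out_eq U).symm⟩

theorem mk_eq {u v : LPoset A} : mk u = mk v ↔ Iso u v :=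
  Quotient.eq (r := LPoset.setoid A)

theorem seq_assoc (U V W : Pomset A) : (U.seq V).seq W = U.seq (V.seq W) := by
  obtain ⟨u, rfl⟩ := exists_mk U
  obtain ⟨v, rfl⟩ := exists_mk V
  obtain ⟨w, rfl⟩ := exists_mk W
  exact mk_eq.2 (seq_assoc_iso u v w)

theorem seq_one (U : Pomset A) : U.seq (one A) = U := by
  obtain ⟨u, rfl⟩ := exists_mk U
  exact mk_eq.2 (seq_empty_iso u)

theorem one_seq (U : Pomset A) : (one A).seq U = U := by
  obtain ⟨u, rfl⟩ := exists_mk U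
  exact mk_eq.2 (empty_seq_iso u)

theorem par_one (U : Pomset A) : U.par (one A) = U := by
  obtain ⟨u, rfl⟩ := exists_mk U
  exact mk_eq.2 (par_empty_iso u)

theorem par_comm (U V : Pomset A) : U.par V = V.par U := by
  obtain ⟨u, rfl⟩ := exists_mk U
  obtain ⟨v, rfl⟩ := exists_mk V
  exact mk_eq.2 (par_comm_iso u v)

theorem one_par (U : Pomset A) : (one A).par U = U := by
  rw [par_comm, par_one]

/-- The number of nodes. -/
noncomputable def size (U : Pomset A) : ℕ :=
  Quotient.lift (s := LPoset.setoid A) (fun u => Nat.card u.carrier)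
    (fun _ _ ⟨h, _⟩ => Nat.card_congr h.toEquiv) U

theorem size_atom (a : A) : (atom a).size = 1 := Nat.card_unique (α := Unit)

theorem size_seq (U V : Pomset A) : (U.seq V).size = U.size + V.size := by
  obtain ⟨u, rfl⟩ := exists_mk U
  obtain ⟨v, rfl⟩ := exists_mk V
  exact Nat.card_sum (α := u.carrier) (β := v.carrier)

theorem size_par (U V : Pomset A) : (U.par V).size = U.size + V.size := by
  obtain ⟨u, rfl⟩ := exists_mk U
  obtain ⟨v, rfl⟩ := exists_mk V
  exact Nat.card_sum (α := u.carrier) (β := v.carrier)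

theorem mk_eq_one {u : LPoset A} : mk u = one A ↔ IsEmpty u.carrier := by
  constructor
  · intro h
    obtain ⟨e, -⟩ := mk_eq.1 h
    exact ⟨fun x => Empty.elim (e x)⟩
  · intro h
    exact mk_eq.2 (iso_empty u)

theorem mk_ne_one {u : LPoset A} : mk u ≠ one A ↔ Nonempty u.carrier := by
  rw [Ne, mk_eq_one, not_isEmpty_iff]

theorem size_pos {U : Pomset A} (h : U ≠ one A) : 0 < U.size := by
  obtain ⟨u, rfl⟩ := exists_mk U
  have := mk_ne_one.1 h
  exact Nat.card_pos

/-- Empty factors are absorbed by the unit laws. Factors that are not empty make both sizes drop,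
which the main induction needs. -/
theorem IsSP.cases_nonempty {U : Pomset A} (h : IsSP U) :
    U = Pomset.one A ∨ (∃ a, U = Pomset.atom a) ∨
      (∃ P Q, IsSP P ∧ IsSP Q ∧ P ≠ Pomset.one A ∧ Q ≠ Pomset.one A ∧ U = P.par Q) ∨
      (∃ P Q, IsSP P ∧ IsSP Q ∧ P ≠ Pomset.one A ∧ Q ≠ Pomset.one A ∧ U = P.seq Q) := by
  induction h with
  | one => exact Or.inl rfl
  | atom a => exact Or.inr (Or.inl ⟨a, rfl⟩)
  | @par P Q hP hQ ihP ihQ =>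
    by_cases h1 : P = Pomset.one A
    · rwa [h1, one_par]
    by_cases h2 : Q = Pomset.one A
    · rwa [h2, par_one]
    exact Or.inr (Or.inr (Or.inl ⟨P, Q, hP, hQ, h1, h2, rfl⟩))
  | @seq P Q hP hQ ihP ihQ =>
    by_cases h1 : P = Pomset.one A
    · rwa [h1, one_seq]
    by_cases h2 : Q = Pomset.one A
    · rwa [h2, seq_one]
    exact Or.inr (Or.inr (Or.inr ⟨P, Q, hP, hQ, h1, h2, rfl⟩))

/-- A greatest node of `P ∥ Q` leaves the other factor empty, and one of `P · Q` lies in `Q` unless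
`Q` is empty. So it can be split off while the rest stays series-parallel. -/
theorem IsSP.exists_seq_atom {U : Pomset A} (h : IsSP U) {u : LPoset A} (hu : U = mk u)
    {m : u.carrier} (hm : IsTop m) : ∃ V, IsSP V ∧ U = V.seq (.atom (u.label m)) := by
  induction h generalizing u with
  | one => exact (mk_eq_one.1 hu.symm).elim m
  | atom a =>
    obtain ⟨e, he⟩ := mk_eq.1 hu.symm
    have : u.label m = a := (he m).symm
    exact ⟨_, IsSP.one, by rw [one_seq, this]⟩
  | @par P Q hP hQ ihP ihQ =>
    obtain ⟨p, rfl⟩ := exists_mk P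
    obtain ⟨q, rfl⟩ := exists_mk Q
    obtain ⟨e, he⟩ := mk_eq.1 hu.symm
    have hm' : IsTop (e m) := fun y => e.symm.le_iff_le.1 (by simpa using hm _)
    rw [← he m]
    revert hm'
    induction e m using par_ind with
    | left x =>
      intro hx
      have hq : mk q = Pomset.one A := mk_eq_one.2 ⟨fun y => not_parR_le_parL (hx (parR p y))⟩
      rw [hq, par_one]
      exact ihP rfl fun y => parL_le_parL.1 (hx (parL q y))
    | right x =>
      intro hx
      have hp : mk p = Pomset.one A := mk_eq_one.2 ⟨fun y => not_parL_le_parR (hx (parL q y))⟩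
      rw [hp, one_par]
      exact ihQ rfl fun y => parR_le_parR.1 (hx (parR p y))
  | @seq P Q hP hQ ihP ihQ =>
    obtain ⟨p, rfl⟩ := exists_mk P
    obtain ⟨q, rfl⟩ := exists_mk Q
    obtain ⟨e, he⟩ := mk_eq.1 hu.symm
    have hm' : IsTop (e m) := fun y => e.symm.le_iff_le.1 (by simpa using hm _)
    rw [← he m]
    revert hm'
    induction e m using seq_ind with
    | left x =>
      intro hx
      have hq : mk q = Pomset.one A := mk_eq_one.2 ⟨fun y => not_seqR_le_seqL (hx (seqR p y))⟩
      rw [hq, seq_one]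
      exact ihP rfl fun y => seqL_le_seqL.1 (hx (seqL q y))
    | right x =>
      intro hx
      obtain ⟨V, hV, h⟩ := ihQ rfl fun y => seqR_le_seqR.1 (hx (seqR p y))
      exact ⟨_, hP.seq hV, by rw [h, seq_assoc]; rfl⟩

theorem IsSP.exists_atom_seq {U : Pomset A} (h : IsSP U) {u : LPoset A} (hu : U = mk u)
    {m : u.carrier} (hm : IsBot m) : ∃ V, IsSP V ∧ U = (Pomset.atom (u.label m)).seq V := by
  induction h generalizing u with
  | one => exact (mk_eq_one.1 hu.symm).elim m
  | atom a =>
    obtain ⟨e, he⟩ := mk_eq.1 hu.symm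
    have : u.label m = a := (he m).symm
    exact ⟨_, IsSP.one, by rw [seq_one, this]⟩
  | @par P Q hP hQ ihP ihQ =>
    obtain ⟨p, rfl⟩ := exists_mk P
    obtain ⟨q, rfl⟩ := exists_mk Q
    obtain ⟨e, he⟩ := mk_eq.1 hu.symm
    have hm' : IsBot (e m) := fun y => e.symm.le_iff_le.1 (by simpa using hm _)
    rw [← he m]
    revert hm'
    induction e m using par_ind with
    | left x =>
      intro hx
      have hq : mk q = Pomset.one A := mk_eq_one.2 ⟨fun y => not_parL_le_parR (hx (parR p y))⟩
      rw [hq, par_one]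
      exact ihP rfl fun y => parL_le_parL.1 (hx (parL q y))
    | right x =>
      intro hx
      have hp : mk p = Pomset.one A := mk_eq_one.2 ⟨fun y => not_parR_le_parL (hx (parL q y))⟩
      rw [hp, one_par]
      exact ihQ rfl fun y => parR_le_parR.1 (hx (parR p y))
  | @seq P Q hP hQ ihP ihQ =>
    obtain ⟨p, rfl⟩ := exists_mk P
    obtain ⟨q, rfl⟩ := exists_mk Q
    obtain ⟨e, he⟩ := mk_eq.1 hu.symm
    have hm' : IsBot (e m) := fun y => e.symm.le_iff_le.1 (by simpa using hm _)
    rw [← he m]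
    revert hm'
    induction e m using seq_ind with
    | left x =>
      intro hx
      obtain ⟨V, hV, h⟩ := ihP rfl fun y => seqL_le_seqL.1 (hx (seqL q y))
      exact ⟨_, hV.seq hQ, by rw [h, seq_assoc]; rfl⟩
    | right x =>
      intro hx
      have hp : mk p = Pomset.one A := mk_eq_one.2 ⟨fun y => not_seqR_le_seqL (hx (seqL q y))⟩
      rw [hp, one_seq]
      exact ihQ rfl fun y => seqR_le_seqR.1 (hx (seqR p y))

section Good

variable {Var Val : Type*}

/-- The pomset has a representative with the seven properties. -/
def Good (U : Pomset (Letter Var Val)) : Prop := ∃ u, U = mk u ∧ u.Good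

theorem good_mk {u : LPoset (Letter Var Val)} : (mk u).Good ↔ u.Good :=
  ⟨fun ⟨_, h, hv⟩ => hv.of_iso (mk_eq.1 h).symm, fun h => ⟨u, rfl, h⟩⟩

end Good

end Pomset

/-! ### Cutting at a state-node comparable to all nodes -/

namespace LPoset

variable {Var Val : Type*} {u : LPoset (Letter Var Val)}

section Cut

variable {c : u.carrier}

/-- A path to the maximum cannot jump over `c`: if an action `a` with predecessor `x < c` were above
`c`, then `c ≤ x`. So `a < c`, its successor is at most `c`, and the path meets `c`. -/
theorem Good.hasSink_Iic (hu : u.Good) (hc : u.IsStateNode c) (hcmp : ∀ x, x ≤ c ∨ c ≤ x)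
    {x : u.carrier} {v : Var} (hx : x ≤ c) (hv : v ∈ (u.stateAt x).dom) :
    HasSink (Set.Iic c) v x := by
  obtain ⟨m, -, hm, h⟩ := hu.sink x v hv
  refine ⟨c, le_rfl, fun y hy => hy, ?_⟩
  clear hv
  induction h using ReflTransGen.head_induction_on with
  | refl => rw [le_antisymm hx (hm c trivial)]
  | @head x y h1 h2 ih =>
    obtain ⟨a, b, -, -, -, ha, hp, hs, hv⟩ := h1
    rcases hx.eq_or_lt with rfl | hx'
    · rfl
    have hne : a ≠ c := by
      rintro rfl
      exact hc.label_ne ha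
    have hac : a < c := by
      refine ((hcmp a).resolve_right fun h => ?_).lt_of_ne hne
      exact hx'.not_ge (hp.2 c (h.lt_of_ne hne.symm))
    have hy : y ≤ c := hs.2 c hac
    exact (ih hy).head ⟨a, b, hac.le, hx, hy, ha, hp, hs, hv⟩

theorem Good.hasSource_Iic (hu : u.Good) {x : u.carrier} {v : Var} (hx : x ≤ c)
    (hv : v ∈ (u.stateAt x).dom) : HasSource (Set.Iic c) v x := by
  obtain ⟨s, -, hs, h, h'⟩ := hu.source x v hv
  have hsx := le_of_steps h
  refine ⟨s, hsx.trans hx, hs, ?_, ?_⟩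
  · clear hv hsx h'
    induction h with
    | refl => rfl
    | @tail x y h1 h2 ih =>
      have hlt := h2.lt
      obtain ⟨a, b, -, -, -, ha, hp, hs, hv⟩ := h2
      exact (ih (hlt.le.trans hx)).tail ⟨a, b, hs.1.le.trans hx, hlt.le.trans hx, hx, ha, hp,
        hs, hv⟩
  · rcases h' with h' | ⟨a, -, ha, hsa⟩
    · exact Or.inl fun y _ => h' y trivial
    · exact Or.inr ⟨a, (hsa.1.le.trans hsx).trans hx, ha, hsa⟩

/-- Dually, the history of `v` either passes through `c`, which is then a source as the least node
of the upper part, or stays strictly above `c`. In the latter case it begins at an assignment, which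
is above `c` too. -/
theorem Good.hasSource_Ici (hu : u.Good) (hc : u.IsStateNode c) (hcmp : ∀ x, x ≤ c ∨ c ≤ x)
    {x : u.carrier} {v : Var} (hx : c ≤ x) (hv : v ∈ (u.stateAt x).dom) :
    HasSource (Set.Ici c) v x := by
  obtain ⟨s, -, hs, h, h'⟩ := hu.source x v hv
  have hle : ∀ {a b y : _}, u.label a = Sum.inl b → u.IsSuccessor y a → c < y → c < a := by
    intro a b y ha hy hcy
    have hne : a ≠ c := by
      rintro rfl
      exact hc.label_ne ha
    refine ((hcmp a).resolve_left fun h => ?_).lt_of_ne hne.symm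
    exact hcy.not_ge (hy.2 c (h.lt_of_ne hne))
  have hcs : ∀ y, c = y → v ∈ (u.stateAt y).dom → HasSource (Set.Ici c) v y := by
    rintro y rfl hy
    exact ⟨c, le_rfl, hy, .refl, Or.inl fun z hz => hz⟩
  clear hv
  induction h with
  | refl =>
    rcases hx.eq_or_lt with rfl | hx'
    · exact hcs _ rfl hs
    refine ⟨s, hx, hs, .refl, ?_⟩
    rcases h' with h' | ⟨a, -, ha, hsa⟩
    · exact absurd (h' c trivial) hx'.not_ge
    · refine Or.inr ⟨a, ?_, ha, hsa⟩
      rcases ha with ⟨n, ha⟩ | ⟨v', ha⟩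
      · exact (hle ha hsa hx').le
      · exact (hle ha hsa hx').le
  | @tail y x h1 h2 ih =>
    rcases hx.eq_or_lt with rfl | hx'
    · exact hcs _ rfl (mem_dom_of_steps (h1.tail h2) hs)
    obtain ⟨a, b, -, -, -, ha, hp, hsa, hv⟩ := h2
    have hca := hle ha hsa hx'
    have hy := hp.2 c hca
    exact (ih hy).tail (.single ⟨a, b, hca.le, hy, hx, ha, hp, hsa, hv⟩)

theorem Good.hasSink_Ici (hu : u.Good) {x : u.carrier} {v : Var} (hx : c ≤ x)
    (hv : v ∈ (u.stateAt x).dom) : HasSink (Set.Ici c) v x := by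
  obtain ⟨m, -, hm, h⟩ := hu.sink x v hv
  refine ⟨m, hx.trans (hm x trivial), fun y _ => hm y trivial, ?_⟩
  clear hv
  induction h using ReflTransGen.head_induction_on with
  | refl => rfl
  | @head x y h1 h2 ih =>
    have hlt := h1.lt
    obtain ⟨a, b, -, -, -, ha, hp, hs, hv⟩ := h1
    have hy := hx.trans hlt.le
    exact (ih hy).head ⟨a, b, hx.trans hp.1.le, hx, hy, ha, hp, hs, hv⟩

end Cut

section Split

variable {v : LPoset (Letter Var Val)} {γ : State Var Val}

variable (u γ v) in
/-- The node labelled `γ` in `(u · γ) · v`. -/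
def cut : (seq (seq u (single (Sum.inr γ))) v).carrier := seqL v (seqR u ())

variable (u γ v) in
/-- The inclusion of `γ · v` into `(u · γ) · v`. -/
def fromCut (z : (seq (single (Sum.inr γ)) v).carrier) :
    (seq (seq u (single (Sum.inr γ))) v).carrier :=
  Sum.elim (fun _ => cut u v γ) (seqR _) (ofLex z)

@[simp] theorem fromCut_seqR {x : v.carrier} : fromCut u v γ (seqR _ x) = seqR _ x := rfl

@[simp] theorem label_fromCut (z : (seq (single (Sum.inr γ)) v).carrier) :
    (seq (seq u (single (Sum.inr γ))) v).label (fromCut u v γ z) = (seq _ v).label z := by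
  induction z using seq_ind with
  | left x => rfl
  | right x => rfl

theorem stateAt_fromCut (z : (seq (single (Sum.inr γ)) v).carrier) :
    (seq (seq u (single (Sum.inr γ))) v).stateAt (fromCut u v γ z) = (seq _ v).stateAt z := by
  simp [stateAt]

theorem isStateNode_cut : (seq (seq u (single (Sum.inr γ))) v).IsStateNode (cut u v γ) :=
  ⟨γ, rfl⟩

theorem seqL_le_cut (x : (seq u (single (Sum.inr γ))).carrier) : seqL v x ≤ cut u v γ := by
  refine seqL_le_seqL.2 ?_
  induction x using seq_ind with
  | left x => exact seqL_le_seqR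
  | right x => exact le_rfl

theorem cut_lt_seqR (x : v.carrier) : cut u v γ < seqR _ x := seqL_lt_seqR

theorem le_cut_or_cut_le (z : (seq (seq u (single (Sum.inr γ))) v).carrier) :
    z ≤ cut u v γ ∨ cut u v γ ≤ z := by
  induction z using seq_ind with
  | left x => exact Or.inl (seqL_le_cut x)
  | right x => exact Or.inr (cut_lt_seqR x).le

theorem range_seqL :
    Set.range (seqL (u := seq u (single (Sum.inr γ))) v) = Set.Iic (cut u v γ) := by
  ext z
  constructor
  · rintro ⟨x, rfl⟩
    exact seqL_le_cut x
  · intro h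
    induction z using seq_ind with
    | left x => exact ⟨x, rfl⟩
    | right x => exact absurd h (cut_lt_seqR x).not_ge

theorem fromCut_le_iff {x y : (seq (single (Sum.inr γ)) v).carrier} :
    fromCut u v γ x ≤ fromCut u v γ y ↔ x ≤ y := by
  induction x using seq_ind with
  | left x =>
    induction y using seq_ind with
    | left y => exact iff_of_true le_rfl (seqL_le_seqL.2 le_rfl)
    | right y => exact iff_of_true seqL_le_seqR seqL_le_seqR
  | right x =>
    induction y using seq_ind with
    | left y => exact iff_of_false not_seqR_le_seqL not_seqR_le_seqL
    | right y => simp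

theorem range_fromCut : Set.range (fromCut u v γ) = Set.Ici (cut u v γ) := by
  ext z
  constructor
  · rintro ⟨x, rfl⟩
    exact fromCut_le_iff (x := seqL v ()).2 (by
      induction x using seq_ind with
      | left x => exact le_rfl
      | right x => exact seqL_le_seqR)
  · intro h
    induction z using seq_ind with
    | left x => exact ⟨seqL v (), le_antisymm h (seqL_le_cut x)⟩
    | right x => exact ⟨seqR _ x, rfl⟩

theorem isArm_seqL : IsArm (seqL (u := seq u (single (Sum.inr γ))) v) where
  le_iff := seqL_le_seqL
  label_act := Iff.rfl
  below := by
    intro a b _ y hy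
    induction y using seq_ind with
    | left y => exact ⟨y, seqL_lt_seqL.1 hy, le_rfl⟩
    | right y => exact absurd hy not_seqR_lt_seqL
  above := by
    intro a b ha y hy
    induction y using seq_ind with
    | left y => exact ⟨y, seqL_lt_seqL.1 hy, le_rfl⟩
    | right y =>
      refine ⟨seqR u (), ?_, seqL_le_seqR⟩
      induction a using seq_ind with
      | left a => exact seqL_lt_seqR
      | right a => cases ha

theorem isArm_fromCut : IsArm (fromCut u v γ) where
  le_iff := fromCut_le_iff
  label_act := by simp
  below := by
    intro a b ha y hy
    induction a using seq_ind with
    | left a => cases ha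
    | right a =>
      induction y using seq_ind with
      | left y => exact ⟨seqL v (), seqL_lt_seqR, seqL_le_cut y⟩
      | right y => exact ⟨seqR _ y, by simpa using hy, le_rfl⟩
  above := by
    intro a b ha y hy
    induction a using seq_ind with
    | left a => cases ha
    | right a =>
      induction y using seq_ind with
      | left y => exact absurd hy not_seqR_lt_seqL
      | right y => exact ⟨seqR _ y, by simpa using hy, le_rfl⟩

/-- Nothing is lost in this restriction: the cut node is a sink for all variables reaching it, so
the states of the part are those of the whole. -/
theorem Good.left_of_seq (h : (seq (seq u (single (Sum.inr γ))) v).Good) :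
    (seq u (single (Sum.inr γ))).Good := by
  have hf := isArm_seqL (u := u) (v := v) (γ := γ)
  have hsrc : ∀ x w, w ∈ ((seq u (single (Sum.inr γ))).stateAt x).dom →
      HasSource (Set.range (seqL (u := seq u (single (Sum.inr γ))) v)) w (seqL v x) := by
    intro x w hw
    rw [range_seqL]
    exact h.hasSource_Iic (seqL_le_cut x) hw
  have hsnk : ∀ x w, w ∈ ((seq u (single (Sum.inr γ))).stateAt x).dom →
      HasSink (Set.range (seqL (u := seq u (single (Sum.inr γ))) v)) w (seqL v x) := by
    intro x w hw
    rw [range_seqL]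
    exact h.hasSink_Iic isStateNode_cut le_cut_or_cut_le (seqL_le_cut x) hw
  refine h.pullback hf ?_ ?_ ?_ ?_ (fun x w _ => hsrc x w) (fun x w _ => hsnk x w)
  · obtain ⟨m, hm, hm'⟩ := h.bot
    obtain ⟨m, rfl⟩ : m ∈ Set.range (seqL (u := seq u (single (Sum.inr γ))) v) := by
      rw [range_seqL]
      exact hm _
    exact ⟨m, fun y => seqL_le_seqL.1 (hm _), hm'⟩
  · exact ⟨seqR u (), fun y => seqL_le_seqL.1 (seqL_le_cut (v := v) y), γ, rfl⟩
  · intro x y hx hy hxy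
    obtain ⟨z, hz, hxz, hzy⟩ := h.separated (seqL v x) (seqL v y) hx hy (seqL_lt_seqL.2 hxy)
    obtain ⟨z, rfl⟩ : z ∈ Set.range (seqL (u := seq u (single (Sum.inr γ))) v) := by
      rw [range_seqL]
      exact hzy.le.trans (seqL_le_cut y)
    exact ⟨z, hz, seqL_lt_seqL.1 hxz, seqL_lt_seqL.1 hzy⟩
  · intro x w n
    constructor
    · intro hn
      have hw := State.mem_dom_iff.2 ⟨n, hn⟩
      exact ⟨hn, hsrc x w hw, hsnk x w hw⟩
    · exact fun h => h.1

theorem Good.right_of_seq (h : (seq (seq u (single (Sum.inr γ))) v).Good) :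
    (seq (single (Sum.inr γ)) v).Good := by
  have hf := isArm_fromCut (u := u) (v := v) (γ := γ)
  have hle : ∀ x, cut u v γ ≤ fromCut u v γ x := fun x => by
    rw [← Set.mem_Ici, ← range_fromCut]
    exact ⟨x, rfl⟩
  have hsrc : ∀ x w, w ∈ ((seq (seq u (single (Sum.inr γ))) v).stateAt (fromCut u v γ x)).dom →
      HasSource (Set.range (fromCut u v γ)) w (fromCut u v γ x) := by
    intro x w hw
    rw [range_fromCut]
    exact h.hasSource_Ici isStateNode_cut le_cut_or_cut_le (hle x) hw
  have hsnk : ∀ x w, w ∈ ((seq (seq u (single (Sum.inr γ))) v).stateAt (fromCut u v γ x)).dom →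
      HasSink (Set.range (fromCut u v γ)) w (fromCut u v γ x) := by
    intro x w hw
    rw [range_fromCut]
    exact h.hasSink_Ici (hle x) hw
  refine h.pullback hf ?_ ?_ ?_ ?_ (fun x w _ => hsrc x w) (fun x w _ => hsnk x w)
  · exact ⟨seqL v (), fun y => fromCut_le_iff.1 (hle y), γ, rfl⟩
  · obtain ⟨m, hm, hm'⟩ := h.top
    obtain ⟨m, rfl⟩ : m ∈ Set.range (fromCut u v γ) := by
      rw [range_fromCut]
      exact hm _
    exact ⟨m, fun y => fromCut_le_iff.1 (hm _), hf.isStateNode.1 hm'⟩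
  · intro x y hx hy hxy
    obtain ⟨z, hz, hxz, hzy⟩ := h.separated _ _ (hf.isStateNode.2 hx) (hf.isStateNode.2 hy)
      (hf.lt_iff.2 hxy)
    obtain ⟨z, rfl⟩ : z ∈ Set.range (fromCut u v γ) := by
      rw [range_fromCut]
      exact (hle x).trans hxz.le
    exact ⟨z, hf.isActNode.1 hz, hf.lt_iff.1 hxz, hf.lt_iff.1 hzy⟩
  · intro x w n
    rw [stateAt_fromCut]
    constructor
    · intro hn
      have hw := State.mem_dom_iff.2 ⟨n, hn⟩
      rw [← stateAt_fromCut (u := u)] at hw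
      exact ⟨hn, hsrc x w hw, hsnk x w hw⟩
    · exact fun h => h.1

/-- The two parts share the cut node, and each anchors the other there: sinks of the left part
continue in the right one, sources of the right part come from the left one. -/
theorem Good.seq (h₁ : (LPoset.seq u (single (Sum.inr γ))).Good)
    (h₂ : (LPoset.seq (single (Sum.inr γ)) v).Good) :
    (LPoset.seq (LPoset.seq u (single (Sum.inr γ))) v).Good := by
  have hg₁ : GoodArm (seqL (u := LPoset.seq u (single (Sum.inr γ))) v) :=
    ⟨isArm_seqL, h₁, fun _ _ _ => id⟩
  have hg₂ : GoodArm (fromCut u v γ) :=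
    ⟨isArm_fromCut, h₂, fun x v n => by rw [stateAt_fromCut]; exact id⟩
  have hle : ∀ x, cut u v γ ≤ fromCut u v γ x := fun x => by
    rw [← Set.mem_Ici, ← range_fromCut]
    exact ⟨x, rfl⟩
  have hbot : ∀ m, IsBot m → IsBot (seqL (u := LPoset.seq u (single (Sum.inr γ))) v m) := by
    intro m hm y
    induction y using seq_ind with
    | left y => exact seqL_le_seqL.2 (hm y)
    | right y => exact seqL_le_seqR
  have htop : ∀ m, IsTop m → IsTop (fromCut u v γ m) := by
    intro m hm y
    rcases le_cut_or_cut_le y with hy | hy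
    · exact hy.trans (hle m)
    · rw [← Set.mem_Ici, ← range_fromCut] at hy
      obtain ⟨y, rfl⟩ := hy
      exact fromCut_le_iff.2 (hm y)
  have ha₁ : AnchoredArm (seqL (u := LPoset.seq u (single (Sum.inr γ))) v) := by
    refine ⟨hg₁, ?_, fun m w hm hw => ⟨seqL v m, trivial, hw, .refl, Or.inl fun y _ => hbot m hm y⟩⟩
    intro m w hm hw
    have hmc : m = seqR u () := by
      refine le_antisymm ?_ (hm _)
      exact seqL_le_seqL.1 (seqL_le_cut (v := v) m)
    subst hmc
    obtain ⟨t, -, ht, h⟩ := h₂.sink (seqL v ()) w hw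
    exact ⟨_, trivial, fun y _ => htop t (fun z => ht z trivial) y, hg₂.steps h hw⟩
  have ha₂ : AnchoredArm (fromCut u v γ) := by
    refine ⟨hg₂, fun m w hm hw => ⟨_, trivial, fun y _ => htop m hm y, .refl⟩, ?_⟩
    intro m w hm hw
    have hmc : m = seqL v () := by
      refine le_antisymm (hm _) ?_
      exact fromCut_le_iff.1 (hle m)
    subst hmc
    exact ha₁.hasSource (x := seqR u ()) hw
  refine .of_arms ?_ ?_ ?_ ?_ ?_
  · obtain ⟨m, hm, hm'⟩ := h₁.bot
    exact ⟨_, hbot m hm, hm'⟩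
  · obtain ⟨m, hm, hm'⟩ := h₂.top
    exact ⟨_, htop m hm, isArm_fromCut.isStateNode.2 hm'⟩
  · intro x y hx hy hxy
    induction y using seq_ind with
    | left y =>
      induction x using seq_ind with
      | left x =>
        obtain ⟨z, hz, hxz, hzy⟩ := h₁.separated x y hx hy (seqL_lt_seqL.1 hxy)
        exact ⟨seqL v z, hz, seqL_lt_seqL.2 hxz, seqL_lt_seqL.2 hzy⟩
      | right x => exact absurd hxy not_seqR_lt_seqL
    | right y =>
      -- For A2 across the cut, an action between the cut node and `y` suffices, since every node on
      -- the left is at most the cut node.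
      have key : ∀ x' : (LPoset.seq (single (Sum.inr γ)) v).carrier,
          (LPoset.seq (single (Sum.inr γ)) v).IsStateNode x' → x' < seqR _ y →
          ∃ z, (LPoset.seq (LPoset.seq u (single (Sum.inr γ))) v).IsActNode z ∧
            fromCut u v γ x' < z ∧ z < seqR _ y := by
        intro x' hx' hlt
        obtain ⟨z, hz, hxz, hzy⟩ := h₂.separated x' (seqR _ y) hx' hy hlt
        exact ⟨fromCut u v γ z, isArm_fromCut.isActNode.2 hz, isArm_fromCut.lt_iff.2 hxz,
          isArm_fromCut.lt_iff.2 hzy⟩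
      induction x using seq_ind with
      | left x =>
        obtain ⟨z, hz, hxz, hzy⟩ := key (seqL v ()) ⟨γ, rfl⟩ seqL_lt_seqR
        exact ⟨z, hz, (seqL_le_cut x).trans_lt hxz, hzy⟩
      | right x => exact key (seqR _ x) hx (seqR_lt_seqR.2 (seqR_lt_seqR.1 hxy))
  · intro a b _
    induction a using seq_ind with
    | left a => exact ⟨_, _, ha₁, a, rfl⟩
    | right a => exact ⟨_, _, ha₂, seqR _ a, rfl⟩
  · intro x w n hn
    induction x using seq_ind with
    | left x => exact ⟨_, _, x, ha₁, rfl, hn⟩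
    | right x => exact ⟨_, _, seqR _ x, ha₂, rfl, hn⟩

end Split

end LPoset

/-! ### Restriction and join of states -/

namespace State

variable {Var Val : Type*}

open Classical in
/-- The restriction of a state to the variables that satisfy `D`. -/
noncomputable def restrict (α : State Var Val) (D : Var → Prop) : State Var Val :=
  fun v => if D v then α v else none

theorem restrict_eq_some {α : State Var Val} {D : Var → Prop} {v : Var} {n : Val} :
    α.restrict D v = some n ↔ α v = some n ∧ D v := by
  by_cases h : D v <;> simp [restrict, h]

theorem compatible_restrict (α : State Var Val) (D E : Var → Prop) :
    (α.restrict D).Compatible (α.restrict E) := by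
  rintro v ⟨h1, h2⟩
  obtain ⟨n, h1⟩ := mem_dom_iff.1 h1
  obtain ⟨m, h2⟩ := mem_dom_iff.1 h2
  have h1' := restrict_eq_some.1 h1
  have h2' := restrict_eq_some.1 h2
  rw [h1, h2, ← h1'.1, h2'.1]

theorem join_restrict {α : State Var Val} {D E : Var → Prop} (h : ∀ v ∈ α.dom, D v ∨ E v) :
    (α.restrict D).join (α.restrict E) = α := by
  funext v
  cases hv : α v with
  | none => simp [join, restrict, hv]
  | some n =>
    have hD := h v (mem_dom_iff.2 ⟨n, hv⟩)
    by_cases h1 : D v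
    · simp [join, restrict, h1, hv]
    · simp [join, restrict, h1, hD.resolve_left h1, hv]

theorem sub_join_left (α β : State Var Val) : Sub α (α.join β) := fun v n h => by
  simp [join, h]

theorem sub_join_right {α β : State Var Val} (h : α.Compatible β) : Sub β (α.join β) := by
  intro v n hn
  cases hv : α v with
  | none => simp [join, hv, hn]
  | some m =>
    have := h v ⟨mem_dom_iff.2 ⟨m, hv⟩, mem_dom_iff.2 ⟨n, hn⟩⟩
    simp [join, this, hn]

end State

/-! ### Splitting and joining parallel components -/

namespace LPoset

variable {Var Val : Type*} {u : LPoset (Letter Var Val)}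

section Part

/-- `S` contains the extremal nodes `b` and `t`, and every node that is related to another node
of `S`. -/
structure IsPart (b t : u.carrier) (S : Set u.carrier) : Prop where
  bot_mem : b ∈ S
  top_mem : t ∈ S
  closed : ∀ x ∈ S, x ≠ b → x ≠ t → ∀ y, y ≤ x ∨ x ≤ y → y ∈ S

variable {b t : u.carrier} {S : Set u.carrier}

theorem steps_of_forall_le {v : Var} {x y : u.carrier} (hS : ∀ z ≤ y, z ∈ S)
    (h : ReflTransGen (StepOn Set.univ v) x y) : ReflTransGen (StepOn S v) x y := by
  induction h using ReflTransGen.head_induction_on with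
  | refl => rfl
  | @head x c h1 h2 ih =>
    have hlt := h1.lt
    have hc := le_of_steps h2
    obtain ⟨a, d, -, -, -, ha, hp, hs, hv⟩ := h1
    exact ih.head ⟨a, d, hS _ (hs.1.le.trans hc), hS _ (hlt.le.trans hc), hS _ hc, ha, hp, hs,
      hv⟩

theorem steps_of_forall_ge {v : Var} {x y : u.carrier} (hS : ∀ z, x ≤ z → z ∈ S)
    (h : ReflTransGen (StepOn Set.univ v) x y) : ReflTransGen (StepOn S v) x y := by
  induction h with
  | refl => rfl
  | @tail c y h1 h2 ih =>
    have hlt := h2.lt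
    have hc := le_of_steps h1
    obtain ⟨a, d, -, -, -, ha, hp, hs, hv⟩ := h2
    exact ih.tail ⟨a, d, hS _ (hc.trans hp.1.le), hS _ hc, hS _ (hc.trans hlt.le), ha, hp, hs,
      hv⟩

/-- Everything below an inner node of the part belongs to the part, so its whole history does. At
`t` this fails, because `t` is above the other components as well. -/
theorem Good.hasSource_of_isPart (hu : u.Good) (hb : IsBot b) (hS : IsPart b t S)
    {x : u.carrier} {v : Var} (hx : x ∈ S) (hxt : x ≠ t) (hv : v ∈ (u.stateAt x).dom) :
    HasSource S v x := by
  by_cases hxb : x = b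
  · subst hxb
    exact ⟨x, hx, hv, .refl, Or.inl fun y _ => hb y⟩
  have hle : ∀ z ≤ x, z ∈ S := fun z hz => hS.closed x hx hxb hxt z (Or.inl hz)
  obtain ⟨s, -, hs, h, h'⟩ := hu.source x v hv
  have hsx := le_of_steps h
  refine ⟨s, hle s hsx, hs, steps_of_forall_le hle h, ?_⟩
  rcases h' with h' | ⟨a, -, ha, hsa⟩
  · exact Or.inl fun y _ => h' y trivial
  · exact Or.inr ⟨a, hle a (hsa.1.le.trans hsx), ha, hsa⟩

theorem Good.hasSink_of_isPart (hu : u.Good) (ht : IsTop t) (hS : IsPart b t S)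
    {x : u.carrier} {v : Var} (hx : x ∈ S) (hxb : x ≠ b) (hv : v ∈ (u.stateAt x).dom) :
    HasSink S v x := by
  by_cases hxt : x = t
  · subst hxt
    exact ⟨x, hx, fun y _ => ht y, .refl⟩
  have hle : ∀ z, x ≤ z → z ∈ S := fun z hz => hS.closed x hx hxb hxt z (Or.inr hz)
  obtain ⟨m, -, hm, h⟩ := hu.sink x v hv
  exact ⟨m, hle m (le_of_steps h), fun y _ => hm y trivial, steps_of_forall_ge hle h⟩

/-- The witness is the first action on the path of `v` to the maximum: a part that contains it
contains its successor, and from there a sink. -/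
theorem Good.exists_act_hasSink (hu : u.Good) (hb : IsBot b) (hb' : u.IsStateNode b)
    (ht : IsTop t) (ht' : u.IsStateNode t) (hbt : b ≠ t) {v : Var}
    (hv : v ∈ (u.stateAt b).dom) :
    ∃ a d, u.label a = Sum.inl d ∧ ∀ S, IsPart b t S → a ∈ S → HasSink S v b := by
  obtain ⟨m, -, hm, h⟩ := hu.sink b v hv
  obtain rfl : m = t := le_antisymm (ht m) (hm t trivial)
  rcases h.cases_head with h | ⟨c, h1, h2⟩
  · exact absurd h hbt
  have hc := h1.mem_dom hv
  have hlt := h1.lt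
  obtain ⟨a, d, -, -, -, ha, hp, hs, hv⟩ := h1
  refine ⟨a, d, ha, fun S hS haS => ?_⟩
  have hcS : c ∈ S := hS.closed a haS (by rintro rfl; exact hb'.label_ne ha)
    (by rintro rfl; exact ht'.label_ne ha) c (Or.inr hs.1.le)
  exact (hu.hasSink_of_isPart ht hS hcS hlt.ne' hc).head
    (.single ⟨a, d, haS, hS.bot_mem, hcS, ha, hp, hs, hv⟩)

/-- The witness is the last action on the path of `v` to `t`, or, if that path is trivial, the
assignment whose successor is `t`. -/
theorem Good.exists_act_hasSource (hu : u.Good) (hb : IsBot b) (hb' : u.IsStateNode b)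
    (ht : IsTop t) (ht' : u.IsStateNode t) (hbt : b ≠ t) {v : Var}
    (hv : v ∈ (u.stateAt t).dom) :
    ∃ a d, u.label a = Sum.inl d ∧ ∀ S, IsPart b t S → a ∈ S → HasSource S v t := by
  obtain ⟨s, -, hs, h, h'⟩ := hu.source t v hv
  rcases h.cases_tail with h | ⟨c, h1, h2⟩
  · subst h
    rcases h' with h' | ⟨a, -, ha, hta⟩
    · exact absurd (le_antisymm (hb _) (h' b trivial)) hbt
    · have : ∃ d, u.label a = Sum.inl d := by
        rcases ha with ⟨n, ha⟩ | ⟨v', ha⟩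
        · exact ⟨_, ha⟩
        · exact ⟨_, ha⟩
      obtain ⟨d, hd⟩ := this
      exact ⟨a, d, hd, fun S hS haS => ⟨_, hS.top_mem, hs, .refl, Or.inr ⟨a, haS, ha, hta⟩⟩⟩
  have hc := mem_dom_of_steps h1 hs
  have hlt := h2.lt
  obtain ⟨a, d, -, -, -, ha, hp, hs, hv⟩ := h2
  refine ⟨a, d, ha, fun S hS haS => ?_⟩
  have hcS : c ∈ S := hS.closed a haS (by rintro rfl; exact hb'.label_ne ha)
    (by rintro rfl; exact ht'.label_ne ha) c (Or.inl hp.1.le)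
  exact (hu.hasSource_of_isPart hb hS hcS hlt.ne hc).tail
    (.single ⟨a, d, haS, hcS, hS.top_mem, ha, hp, hs, hv⟩)

end Part

section Bracket

variable {p q r x : LPoset (Letter Var Val)} {α β γ δ σ τ : State Var Val}

/-- The labelled poset `σ · x · τ`. -/
def bracket (σ : State Var Val) (x : LPoset (Letter Var Val)) (τ : State Var Val) :
    LPoset (Letter Var Val) :=
  seq (seq (single (Sum.inr σ)) x) (single (Sum.inr τ))

/-- The first node of `σ · x · τ`. -/
def bBot (σ : State Var Val) (x : LPoset (Letter Var Val)) (τ : State Var Val) :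
    (bracket σ x τ).carrier :=
  seqL _ (seqL (u := single (Sum.inr σ)) x ())

/-- The inclusion of `x` into `σ · x · τ`. -/
def bMid (σ τ : State Var Val) (z : x.carrier) : (bracket σ x τ).carrier :=
  seqL _ (seqR _ z)

/-- The last node of `σ · x · τ`. -/
def bTop (σ : State Var Val) (x : LPoset (Letter Var Val)) (τ : State Var Val) :
    (bracket σ x τ).carrier :=
  seqR (v := single (Sum.inr τ)) _ ()

@[elab_as_elim]
theorem bracket_ind {motive : (bracket σ x τ).carrier → Prop} (bot : motive (bBot σ x τ))
    (mid : ∀ z, motive (bMid σ τ z)) (top : motive (bTop σ x τ))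
    (z : (bracket σ x τ).carrier) : motive z := by
  induction z using seq_ind with
  | left z =>
    induction z using seq_ind with
    | left z => exact bot
    | right z => exact mid z
  | right z => exact top

theorem isBot_bBot : IsBot (bBot σ x τ) := by
  intro z
  induction z using bracket_ind with
  | bot => exact le_rfl
  | mid z => exact seqL_le_seqL.2 seqL_le_seqR
  | top => exact seqL_le_seqR

theorem isTop_bTop : IsTop (bTop σ x τ) := by
  intro z
  induction z using bracket_ind with
  | bot => exact seqL_le_seqR
  | mid z => exact seqL_le_seqR
  | top => exact le_rfl

theorem bMid_le_bMid {y z : x.carrier} : bMid σ τ y ≤ bMid σ τ z ↔ y ≤ z :=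
  seqL_le_seqL.trans seqR_le_seqR

theorem bMid_lt_bMid {y z : x.carrier} : bMid σ τ y < bMid σ τ z ↔ y < z :=
  seqL_lt_seqL.trans seqR_lt_seqR

theorem bBot_lt_bMid (z : x.carrier) : bBot σ x τ < bMid σ τ z :=
  seqL_lt_seqL.2 seqL_lt_seqR

theorem bMid_lt_bTop (z : x.carrier) : bMid σ τ z < bTop σ x τ := seqL_lt_seqR

theorem bBot_lt_bTop : bBot σ x τ < bTop σ x τ := seqL_lt_seqR

theorem label_bBot : (bracket σ x τ).label (bBot σ x τ) = Sum.inr σ := rfl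

theorem label_bMid (z : x.carrier) : (bracket σ x τ).label (bMid σ τ z) = x.label z := rfl

theorem label_bTop : (bracket σ x τ).label (bTop σ x τ) = Sum.inr τ := rfl

theorem isStateNode_bBot : (bracket σ x τ).IsStateNode (bBot σ x τ) := ⟨σ, rfl⟩

theorem isStateNode_bTop : (bracket σ x τ).IsStateNode (bTop σ x τ) := ⟨τ, rfl⟩

theorem stateAt_bMid (z : x.carrier) :
    (bracket σ x τ).stateAt (bMid σ τ z) = x.stateAt z := rfl

theorem exists_bMid_of_label {z : (bracket σ x τ).carrier} {b : Act Var Val}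
    (h : (bracket σ x τ).label z = Sum.inl b) : ∃ y, bMid σ τ y = z := by
  induction z using bracket_ind with
  | bot => cases h
  | mid y => exact ⟨y, rfl⟩
  | top => cases h

/-- The embedding of a union of connected components. -/
structure IsComponent (g : p.carrier → r.carrier) : Prop where
  le_iff : ∀ {x y}, g x ≤ g y ↔ x ≤ y
  label : ∀ x, r.label (g x) = p.label x
  closed : ∀ x y, y ≤ g x ∨ g x ≤ y → y ∈ Set.range g

theorem isComponent_parL : IsComponent (parL (u := p) q) where
  le_iff := parL_le_parL
  label _ := rfl
  closed := by
    intro x y h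
    induction y using par_ind with
    | left y => exact ⟨y, rfl⟩
    | right y => exact (h.elim not_parR_le_parL not_parL_le_parR).elim

theorem isComponent_parR : IsComponent (parR (v := q) p) where
  le_iff := parR_le_parR
  label _ := rfl
  closed := by
    intro x y h
    induction y using par_ind with
    | left y => exact (h.elim not_parL_le_parR not_parR_le_parL).elim
    | right y => exact ⟨y, rfl⟩

/-- The map from `α · p · β` to `σ · r · τ` induced by a map from `p` to `r`. -/
def bMap (α β σ τ : State Var Val) (g : p.carrier → r.carrier) (z : (bracket α p β).carrier) :
    (bracket σ r τ).carrier :=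
  Sum.elim (fun y => Sum.elim (fun _ => bBot σ r τ) (fun z => bMid σ τ (g z)) (ofLex y))
    (fun _ => bTop σ r τ) (ofLex z)

/-- The nodes of `σ · r · τ` that come from `p`, with the two extremal ones. -/
def bSet (σ τ : State Var Val) (g : p.carrier → r.carrier) : Set (bracket σ r τ).carrier :=
  {z | z = bBot σ r τ ∨ z = bTop σ r τ ∨ ∃ y, bMid σ τ (g y) = z}

variable {g : p.carrier → r.carrier}

theorem bMap_bBot : bMap α β σ τ g (bBot α p β) = bBot σ r τ := rfl

theorem bMap_bMid (z : p.carrier) : bMap α β σ τ g (bMid α β z) = bMid σ τ (g z) := rfl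

theorem bMap_bTop : bMap α β σ τ g (bTop α p β) = bTop σ r τ := rfl

theorem range_bMap : Set.range (bMap α β σ τ g) = bSet σ τ g := by
  ext z
  constructor
  · rintro ⟨y, rfl⟩
    induction y using bracket_ind with
    | bot => exact Or.inl rfl
    | mid y => exact Or.inr (Or.inr ⟨y, rfl⟩)
    | top => exact Or.inr (Or.inl rfl)
  · rintro (rfl | rfl | ⟨y, rfl⟩)
    · exact ⟨bBot α p β, rfl⟩
    · exact ⟨bTop α p β, rfl⟩
    · exact ⟨bMid α β y, rfl⟩

theorem IsComponent.isPart (hg : IsComponent g) :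
    IsPart (bBot σ r τ) (bTop σ r τ) (bSet σ τ g) where
  bot_mem := Or.inl rfl
  top_mem := Or.inr (Or.inl rfl)
  closed := by
    rintro x (rfl | rfl | ⟨x, rfl⟩) hb ht y hy
    · exact absurd rfl hb
    · exact absurd rfl ht
    · induction y using bracket_ind with
      | bot => exact Or.inl rfl
      | mid y =>
        rw [bMid_le_bMid, bMid_le_bMid] at hy
        obtain ⟨y, rfl⟩ := hg.closed x y hy
        exact Or.inr (Or.inr ⟨y, rfl⟩)
      | top => exact Or.inr (Or.inl rfl)

theorem IsComponent.isArm (hg : IsComponent g) : IsArm (bMap α β σ τ g) where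
  le_iff := by
    intro y z
    induction y using bracket_ind with
    | bot => exact iff_of_true (isBot_bBot _) (isBot_bBot _)
    | mid y =>
      rw [bMap_bMid]
      induction z using bracket_ind with
      | bot => exact iff_of_false (bBot_lt_bMid _).not_ge (bBot_lt_bMid _).not_ge
      | mid z => rw [bMap_bMid, bMid_le_bMid, bMid_le_bMid, hg.le_iff]
      | top => exact iff_of_true (isTop_bTop _) (isTop_bTop _)
    | top =>
      rw [bMap_bTop]
      induction z using bracket_ind with
      | bot => exact iff_of_false bBot_lt_bTop.not_ge bBot_lt_bTop.not_ge
      | mid z => exact iff_of_false (bMid_lt_bTop _).not_ge (bMid_lt_bTop _).not_ge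
      | top => exact iff_of_true le_rfl le_rfl
  label_act := by
    intro y b
    induction y using bracket_ind with
    | bot => simp [bMap_bBot, label_bBot]
    | mid y => rw [bMap_bMid, label_bMid, label_bMid, hg.label]
    | top => simp [bMap_bTop, label_bTop]
  below := by
    intro a b ha y hy
    obtain ⟨a, rfl⟩ := exists_bMid_of_label ha
    rw [bMap_bMid] at hy
    induction y using bracket_ind with
    | bot => exact ⟨bBot α p β, bBot_lt_bMid _, le_rfl⟩
    | mid y =>
      rw [bMid_lt_bMid] at hy
      obtain ⟨y, rfl⟩ := hg.closed a y (Or.inl hy.le)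
      refine ⟨bMid α β y, bMid_lt_bMid.2 ?_, le_rfl⟩
      simpa only [lt_iff_le_not_ge, hg.le_iff] using hy
    | top => exact absurd hy (bMid_lt_bTop _).not_gt
  above := by
    intro a b ha y hy
    obtain ⟨a, rfl⟩ := exists_bMid_of_label ha
    rw [bMap_bMid] at hy
    induction y using bracket_ind with
    | bot => exact absurd hy (bBot_lt_bMid _).not_gt
    | mid y =>
      rw [bMid_lt_bMid] at hy
      obtain ⟨y, rfl⟩ := hg.closed a y (Or.inr hy.le)
      refine ⟨bMid α β y, bMid_lt_bMid.2 ?_, le_rfl⟩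
      simpa only [lt_iff_le_not_ge, hg.le_iff] using hy
    | top => exact ⟨bTop α p β, bMid_lt_bTop _, le_rfl⟩

/-- The variables of the node `x` that are connected inside `S`. -/
def Connected (S : Set u.carrier) (x : u.carrier) (v : Var) : Prop :=
  HasSource S v x ∧ HasSink S v x

/-- The end states are cut down to the variables connected inside the component, as `Good.pullback`
demands; inner states are connected inside it already. -/
theorem Good.component (hu : (bracket σ r τ).Good) (hg : IsComponent g)
    (hp : Nonempty p.carrier) :
    (bracket (σ.restrict (Connected (bSet σ τ g) (bBot σ r τ))) p
      (τ.restrict (Connected (bSet σ τ g) (bTop σ r τ)))).Good := by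
  set α := σ.restrict (Connected (bSet σ τ g) (bBot σ r τ))
  set β := τ.restrict (Connected (bSet σ τ g) (bTop σ r τ))
  have hf : IsArm (bMap α β σ τ g) := hg.isArm
  have hS : IsPart (bBot σ r τ) (bTop σ r τ) (bSet σ τ g) := hg.isPart
  have hmem : ∀ x, bMap α β σ τ g x ∈ bSet σ τ g := fun x => range_bMap ▸ ⟨x, rfl⟩
  have hsrc : ∀ x v, ¬ IsTop x → v ∈ ((bracket σ r τ).stateAt (bMap α β σ τ g x)).dom →
      HasSource (bSet σ τ g) v (bMap α β σ τ g x) := by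
    intro x v hx hv
    refine hu.hasSource_of_isPart isBot_bBot hS (hmem x) ?_ hv
    intro h
    rw [hf.injective (a₂ := bTop α p β) h] at hx
    exact hx isTop_bTop
  have hsnk : ∀ x v, ¬ IsBot x → v ∈ ((bracket σ r τ).stateAt (bMap α β σ τ g x)).dom →
      HasSink (bSet σ τ g) v (bMap α β σ τ g x) := by
    intro x v hx hv
    refine hu.hasSink_of_isPart isTop_bTop hS (hmem x) ?_ hv
    intro h
    rw [hf.injective (a₂ := bBot α p β) h] at hx
    exact hx isBot_bBot
  refine hu.pullback hf ⟨_, isBot_bBot, isStateNode_bBot⟩ ⟨_, isTop_bTop, isStateNode_bTop⟩ ?_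
    ?_ (by rwa [range_bMap]) (by rwa [range_bMap])
  · have inner : ∀ z x y, (bracket α p β).IsStateNode x → (bracket α p β).IsStateNode y →
        x < y → (x = bMid α β z ∨ y = bMid α β z) →
        ∃ z, (bracket α p β).IsActNode z ∧ x < z ∧ z < y := by
      intro z x y hx hy hxy hz
      obtain ⟨a, ha, hxa, hay⟩ := hu.separated _ _ (hf.isStateNode.2 hx) (hf.isStateNode.2 hy)
        (hf.lt_iff.2 hxy)
      have : a ∈ bSet σ τ g := by
        refine hS.closed (bMid σ τ (g z)) (Or.inr (Or.inr ⟨z, rfl⟩)) (bBot_lt_bMid _).ne'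
          (bMid_lt_bTop _).ne a ?_
        rcases hz with rfl | rfl
        · exact Or.inr hxa.le
        · exact Or.inl hay.le
      rw [← range_bMap (α := α) (β := β)] at this
      obtain ⟨a, rfl⟩ := this
      exact ⟨a, hf.isActNode.1 ha, hf.lt_iff.1 hxa, hf.lt_iff.1 hay⟩
    intro x y hx hy hxy
    induction x using bracket_ind with
    | bot =>
      induction y using bracket_ind with
      | bot => exact absurd hxy (lt_irrefl _)
      | mid y => exact inner y _ _ hx hy hxy (Or.inr rfl)
      | top =>
        -- The separating action of `u` between the end nodes may lie in another component. A node
        -- of `p` yields one here: itself, or the action below it if it is a state-node.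
        obtain ⟨z⟩ := hp
        rcases (bracket α p β).isStateNode_or_isActNode (bMid α β z) with hz | hz
        · obtain ⟨a, ha, h1, h2⟩ := inner z _ _ hx hz (bBot_lt_bMid z) (Or.inr rfl)
          exact ⟨a, ha, h1, h2.trans (bMid_lt_bTop z)⟩
        · exact ⟨_, hz, bBot_lt_bMid z, bMid_lt_bTop z⟩
    | mid x => exact inner x _ _ hx hy hxy (Or.inl rfl)
    | top => exact absurd hxy (isTop_bTop _).not_gt
  · intro x v n
    rw [range_bMap]
    induction x using bracket_ind with
    | bot => exact State.restrict_eq_some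
    | mid x =>
      have he : (bracket σ r τ).stateAt (bMap α β σ τ g (bMid α β x)) =
          (bracket α p β).stateAt (bMid α β x) := by
        simp [bMap_bMid, stateAt, label_bMid, hg.label]
      rw [he]
      refine ⟨fun h => ⟨h, ?_, ?_⟩, fun h => h.1⟩
      · exact hsrc _ v (fun h => (bMid_lt_bTop x).not_ge (h _))
          (he ▸ State.mem_dom_iff.2 ⟨n, h⟩)
      · exact hsnk _ v (fun h => (bBot_lt_bMid x).not_ge (h _))
          (he ▸ State.mem_dom_iff.2 ⟨n, h⟩)
    | top => exact State.restrict_eq_some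

/-- Both restrictions come from the same state, so they are compatible. They cover it because the
witnessing action for each variable lies in one of the two components. -/
theorem Good.exists_of_par (hu : (bracket σ (par p q) τ).Good) (hp : Nonempty p.carrier)
    (hq : Nonempty q.carrier) :
    ∃ α β γ δ : State Var Val, (bracket α p β).Good ∧ (bracket γ q δ).Good ∧
      α.Compatible γ ∧ β.Compatible δ ∧ α.join γ = σ ∧ β.join δ = τ := by
  have hcp := isComponent_parL (p := p) (q := q)
  have hcq := isComponent_parR (p := p) (q := q)
  refine ⟨_, _, _, _, hu.component hcp hp, hu.component hcq hq, State.compatible_restrict _ _ _,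
    State.compatible_restrict _ _ _, State.join_restrict ?_, State.join_restrict ?_⟩
  · intro v hv
    obtain ⟨a, d, ha, h⟩ := hu.exists_act_hasSink isBot_bBot isStateNode_bBot isTop_bTop
      isStateNode_bTop bBot_lt_bTop.ne (v := v) hv
    have hsrc : ∀ S, IsPart (bBot σ (par p q) τ) (bTop σ (par p q) τ) S →
        HasSource S v (bBot σ (par p q) τ) := fun S hS =>
      hu.hasSource_of_isPart isBot_bBot hS hS.bot_mem bBot_lt_bTop.ne hv
    obtain ⟨z, rfl⟩ := exists_bMid_of_label ha
    induction z using par_ind with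
    | left z =>
      exact Or.inl ⟨hsrc _ hcp.isPart, h _ hcp.isPart (Or.inr (Or.inr ⟨z, rfl⟩))⟩
    | right z =>
      exact Or.inr ⟨hsrc _ hcq.isPart, h _ hcq.isPart (Or.inr (Or.inr ⟨z, rfl⟩))⟩
  · intro v hv
    obtain ⟨a, d, ha, h⟩ := hu.exists_act_hasSource isBot_bBot isStateNode_bBot isTop_bTop
      isStateNode_bTop bBot_lt_bTop.ne (v := v) hv
    have hsnk : ∀ S, IsPart (bBot σ (par p q) τ) (bTop σ (par p q) τ) S →
        HasSink S v (bTop σ (par p q) τ) := fun S hS =>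
      hu.hasSink_of_isPart isTop_bTop hS hS.top_mem bBot_lt_bTop.ne' hv
    obtain ⟨z, rfl⟩ := exists_bMid_of_label ha
    induction z using par_ind with
    | left z =>
      exact Or.inl ⟨h _ hcp.isPart (Or.inr (Or.inr ⟨z, rfl⟩)), hsnk _ hcp.isPart⟩
    | right z =>
      exact Or.inr ⟨h _ hcq.isPart (Or.inr (Or.inr ⟨z, rfl⟩)), hsnk _ hcq.isPart⟩

theorem IsComponent.anchoredArm (hg : IsComponent g) (hα : α.Sub σ) (hβ : β.Sub τ)
    (h : (bracket α p β).Good) : AnchoredArm (bMap α β σ τ g) where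
  isArm := hg.isArm
  good := h
  sub := by
    intro x
    induction x using bracket_ind with
    | bot => exact hα
    | mid x =>
      intro v n hn
      rw [bMap_bMid, stateAt_bMid, stateAt, hg.label]
      exact hn
    | top => exact hβ
  top_sink := by
    intro m v hm _
    rw [le_antisymm (isTop_bTop m) (hm _)]
    exact ⟨_, trivial, fun y _ => isTop_bTop y, .refl⟩
  bot_source := by
    intro m v hm hv
    rw [le_antisymm (hm _) (isBot_bBot m)] at hv ⊢
    obtain ⟨n, hn⟩ := State.mem_dom_iff.1 hv
    exact ⟨bBot σ r τ, trivial, State.mem_dom_iff.2 ⟨n, hα v n hn⟩, .refl,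
      Or.inl fun y _ => isBot_bBot y⟩

theorem Good.par (hp : (bracket α p β).Good) (hq : (bracket γ q δ).Good)
    (h₁ : α.Compatible γ) (h₂ : β.Compatible δ) :
    (bracket (α.join γ) (LPoset.par p q) (β.join δ)).Good := by
  have hcp := isComponent_parL (p := p) (q := q)
  have hcq := isComponent_parR (p := p) (q := q)
  have hap := hcp.anchoredArm (State.sub_join_left α γ) (State.sub_join_left β δ) hp
  have haq := hcq.anchoredArm (State.sub_join_right h₁) (State.sub_join_right h₂) hq
  have hcover : ∀ z : (LPoset.par p q).carrier,
      (∃ y, parL q y = z) ∨ ∃ y, parR p y = z := by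
    intro z
    induction z using par_ind with
    | left z => exact Or.inl ⟨z, rfl⟩
    | right z => exact Or.inr ⟨z, rfl⟩
  have sep : ∀ (w : LPoset (Letter Var Val)) (f : w.carrier → (bracket (α.join γ)
      (LPoset.par p q) (β.join δ)).carrier), AnchoredArm f → ∀ x y, x ∈ Set.range f →
      y ∈ Set.range f → IsStateNode _ x → IsStateNode _ y → x < y →
      ∃ z, IsActNode _ z ∧ x < z ∧ z < y := by
    rintro w f hf _ _ ⟨x, rfl⟩ ⟨y, rfl⟩ hx hy hxy
    have ha := hf.isArm
    obtain ⟨z, hz, hxz, hzy⟩ := hf.good.separated x y (ha.isStateNode.1 hx)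
      (ha.isStateNode.1 hy) (ha.lt_iff.1 hxy)
    exact ⟨f z, ha.isActNode.2 hz, ha.lt_iff.2 hxz, ha.lt_iff.2 hzy⟩
  refine .of_arms ⟨_, isBot_bBot, isStateNode_bBot⟩ ⟨_, isTop_bTop, isStateNode_bTop⟩ ?_ ?_ ?_
  · have inner : ∀ z x y, IsStateNode _ x → IsStateNode _ y → x < y →
        (x = bMid (α.join γ) (β.join δ) z ∨ y = bMid (α.join γ) (β.join δ) z) →
        ∃ z, (bracket (α.join γ) (LPoset.par p q) (β.join δ)).IsActNode z ∧ x < z ∧ z < y := by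
      intro z x y hx hy hxy hz
      have part : ∀ S, IsPart (bBot (α.join γ) (LPoset.par p q) (β.join δ)) (bTop _ _ _) S →
          bMid (α.join γ) (β.join δ) z ∈ S → x ∈ S ∧ y ∈ S := by
        intro S hS hzS
        have hcl := hS.closed _ hzS (bBot_lt_bMid _).ne' (bMid_lt_bTop _).ne
        rcases hz with rfl | rfl
        · exact ⟨hzS, hcl _ (Or.inr hxy.le)⟩
        · exact ⟨hcl _ (Or.inl hxy.le), hzS⟩
      rcases hcover z with ⟨z', rfl⟩ | ⟨z', rfl⟩
      · obtain ⟨h3, h4⟩ := part _ hcp.isPart (Or.inr (Or.inr ⟨z', rfl⟩))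
        rw [← range_bMap (α := α) (β := β)] at h3 h4
        exact sep _ _ hap x y h3 h4 hx hy hxy
      · obtain ⟨h3, h4⟩ := part _ hcq.isPart (Or.inr (Or.inr ⟨z', rfl⟩))
        rw [← range_bMap (α := γ) (β := δ)] at h3 h4
        exact sep _ _ haq x y h3 h4 hx hy hxy
    intro x y hx hy hxy
    induction x using bracket_ind with
    | bot =>
      induction y using bracket_ind with
      | bot => exact absurd hxy (lt_irrefl _)
      | mid y => exact inner y _ _ hx hy hxy (Or.inr rfl)
      -- Both components contain the two end nodes, so either of them provides the action.
      | top => exact sep _ _ hap _ _ ⟨bBot α p β, rfl⟩ ⟨bTop α p β, rfl⟩ hx hy hxy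
    | mid x => exact inner x _ _ hx hy hxy (Or.inl rfl)
    | top => exact absurd hxy (isTop_bTop _).not_gt
  · intro a b ha
    obtain ⟨z, rfl⟩ := exists_bMid_of_label ha
    rcases hcover z with ⟨z, rfl⟩ | ⟨z, rfl⟩
    · exact ⟨_, _, hap, bMid α β z, rfl⟩
    · exact ⟨_, _, haq, bMid γ δ z, rfl⟩
  · have join_cases : ∀ (α γ : State Var Val) (v : Var) (n : Val), α.join γ v = some n →
        α v = some n ∨ γ v = some n := by
      intro α γ v n h
      rcases Option.or_eq_some_iff.1 h with h | h
      · exact Or.inl h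
      · exact Or.inr h.2
    intro x v n hn
    induction x using bracket_ind with
    | bot =>
      rcases join_cases α γ v n hn with h | h
      · exact ⟨_, _, bBot α p β, hap, rfl, h⟩
      · exact ⟨_, _, bBot γ q δ, haq, rfl, h⟩
    | mid z =>
      rcases hcover z with ⟨z, rfl⟩ | ⟨z, rfl⟩
      · exact ⟨_, _, bMid α β z, hap, rfl, hn⟩
      · exact ⟨_, _, bMid γ δ z, haq, rfl, hn⟩
    | top =>
      rcases join_cases β δ v n hn with h | h
      · exact ⟨_, _, bTop α p β, hap, rfl, h⟩
      · exact ⟨_, _, bTop γ q δ, haq, rfl, h⟩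

end Bracket

end LPoset

/-! ### A single action between two states -/

namespace State

variable {Var Val : Type*}

theorem update_eq_nextValue {α : State Var Val} {b : Act Var Val} (h : α.UpdateExists b)
    (v : Var) : α.update b v = α.nextValue v b := by
  cases b with
  | assign w n =>
    by_cases hw : v = w
    · simp [update, nextValue, hw]
    · simp [update, nextValue, hw, Ne.symm hw]
  | copy w v' =>
    have h : v' ∈ α.dom := h
    by_cases hw : v = w
    · simp only [update, nextValue, if_pos hw, if_pos (And.intro hw.symm h)]
    · simp only [update, nextValue, if_neg hw, if_neg (fun h' : w = v ∧ _ => hw h'.1.symm)]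

theorem records_update {α : State Var Val} {b : Act Var Val} (h : α.UpdateExists b) :
    α.Records b (α.update b) := by
  cases b with
  | assign w n => simp [Records, update]
  | copy w v' =>
    obtain ⟨n, hn⟩ := mem_dom_iff.1 (show v' ∈ α.dom from h)
    exact ⟨n, hn, by simp [update, hn], by simp [update, hn]⟩

theorem Records.updateExists {α β : State Var Val} {b : Act Var Val} (h : α.Records b β) :
    α.UpdateExists b := by
  cases b with
  | assign w n => trivial
  | copy w v' =>
    obtain ⟨n, hn, -⟩ := h
    exact mem_dom_iff.2 ⟨n, hn⟩

end State

namespace LPoset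

variable {Var Val : Type*} {p q x : LPoset (Letter Var Val)} {α σ τ : State Var Val}
  {b : Act Var Val}

theorem good_single (α : State Var Val) : (single (A := Letter Var Val) (Sum.inr α)).Good where
  bot := ⟨(), fun _ => le_rfl, α, rfl⟩
  top := ⟨(), fun _ => le_rfl, α, rfl⟩
  separated := fun x y _ _ h => absurd h (lt_irrefl (α := Unit) ())
  act := fun a b h => by cases h
  sink := fun x v _ => ⟨x, trivial, fun _ _ => le_rfl, .refl⟩
  source := fun x v hv => ⟨x, trivial, hv, .refl, Or.inl fun _ _ => le_rfl⟩

theorem eq_bMid {z : (bracket σ (single (Sum.inl b)) τ).carrier} {b' : Act Var Val}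
    (h : (bracket σ (single (Sum.inl b)) τ).label z = Sum.inl b') :
    z = bMid σ τ () ∧ b' = b := by
  obtain ⟨⟨⟩, rfl⟩ := exists_bMid_of_label h
  exact ⟨rfl, (Sum.inl.inj h).symm⟩

theorem isPredecessor_bBot :
    (bracket σ (single (Sum.inl b)) τ).IsPredecessor (bBot _ _ _) (bMid σ τ ()) := by
  refine ⟨bBot_lt_bMid _, fun y hy => ?_⟩
  induction y using bracket_ind with
  | bot => exact le_rfl
  | mid y => exact absurd hy (lt_irrefl _)
  | top => exact absurd hy (isTop_bTop _).not_gt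

theorem isSuccessor_bTop :
    (bracket σ (single (Sum.inl b)) τ).IsSuccessor (bTop _ _ _) (bMid σ τ ()) := by
  refine ⟨bMid_lt_bTop _, fun y hy => ?_⟩
  induction y using bracket_ind with
  | bot => exact absurd hy (isBot_bBot _).not_gt
  | mid y => exact absurd hy (lt_irrefl _)
  | top => exact le_rfl

theorem stepOn_bracket_single {v : Var} {y z : (bracket σ (single (Sum.inl b)) τ).carrier}
    (h : StepOn Set.univ v y z) : z = bTop _ _ _ ∧ τ v = σ.nextValue v b := by
  obtain ⟨a, b', -, -, -, ha, hp, hs, hv⟩ := h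
  obtain ⟨rfl, rfl⟩ := eq_bMid ha
  obtain rfl := hp.unique isPredecessor_bBot
  obtain rfl := hs.unique isSuccessor_bTop
  exact ⟨rfl, hv⟩

/-- Goodness determines `τ`: assigned variables are fixed by the recorded effect, variables of `σ`
by their path to the maximum, and `τ` knows nothing else because each of its variables has a source.
-/
theorem good_bracket_single_iff :
    (bracket σ (single (Sum.inl b)) τ).Good ↔ σ.UpdateExists b ∧ τ = σ.update b := by
  constructor
  · intro h
    have hr : σ.Records b τ := h.records (a := bMid σ τ ()) rfl isPredecessor_bBot isSuccessor_bTop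
    refine ⟨hr.updateExists, ?_⟩
    have hpath : ∀ v ∈ σ.dom, τ v = σ.nextValue v b := by
      intro v hv
      obtain ⟨m, -, hm, h⟩ := h.sink (bBot _ _ _) v hv
      rcases h.cases_head with rfl | ⟨c, h1, -⟩
      · exact absurd (hm (bTop _ _ _) trivial) bBot_lt_bTop.not_ge
      · exact (stepOn_bracket_single h1).2
    have hassign : ∀ v, (bracket σ (single (Sum.inl b)) τ).AssignsTo (bMid σ τ ()) v →
        τ v = σ.update b v := by
      rintro v (⟨n, hn⟩ | ⟨v', hn⟩)
      · obtain rfl : b = _ := Sum.inl.inj hn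
        simpa [State.update] using show τ v = some n from hr
      · obtain rfl : b = _ := Sum.inl.inj hn
        obtain ⟨n, h1, h2, -⟩ := hr
        simp [State.update, h1, h2]
    funext v
    by_cases hv : v ∈ τ.dom
    · obtain ⟨s, -, hs, hst, h'⟩ := h.source (bTop _ _ _) v hv
      rcases hst.cases_tail with h1 | ⟨c, -, h1⟩
      · subst h1
        rcases h' with h' | ⟨a, -, ha, -⟩
        · exact absurd (h' (bBot _ _ _) trivial) bBot_lt_bTop.not_ge
        · have : ∃ b', (bracket σ (single (Sum.inl b)) τ).label a = Sum.inl b' := by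
            rcases ha with ⟨n, ha⟩ | ⟨v', ha⟩
            · exact ⟨_, ha⟩
            · exact ⟨_, ha⟩
          obtain ⟨b', hb'⟩ := this
          obtain ⟨rfl, -⟩ := eq_bMid hb'
          exact hassign v ha
      · rw [State.update_eq_nextValue hr.updateExists]
        exact (stepOn_bracket_single h1).2
    · have hτ : τ v = none := by
        cases hn : τ v with
        | none => rfl
        | some n => exact absurd (State.mem_dom_iff.2 ⟨n, hn⟩) hv
      by_cases hv' : v ∈ σ.dom
      · obtain ⟨n, hn⟩ := State.nextValue_mem hv' b
        rw [← hpath v hv', hτ] at hn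
        cases hn
      · have hσ : σ v = none := by
          cases hn : σ v with
          | none => rfl
          | some n => exact absurd (State.mem_dom_iff.2 ⟨n, hn⟩) hv'
        cases b with
        | assign w n =>
          by_cases hw : v = w
          · subst hw
            exact hassign v (Or.inl ⟨n, rfl⟩)
          · simp [State.update, hw, hσ, hτ]
        | copy w v' =>
          by_cases hw : v = w
          · subst hw
            exact hassign v (Or.inr ⟨v', rfl⟩)
          · simp [State.update, hw, hσ, hτ]
  · rintro ⟨hb, rfl⟩
    have hstep : ∀ v, StepOn (u := bracket σ (single (Sum.inl b)) (σ.update b)) Set.univ v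
        (bBot _ _ _) (bTop _ _ _) := fun v =>
      ⟨bMid _ _ (), b, trivial, trivial, trivial, rfl, isPredecessor_bBot, isSuccessor_bTop,
        State.update_eq_nextValue hb v⟩
    refine ⟨⟨_, isBot_bBot, isStateNode_bBot⟩, ⟨_, isTop_bTop, isStateNode_bTop⟩, ?_, ?_, ?_, ?_⟩
    · intro y z hy hz hyz
      refine ⟨bMid _ _ (), ⟨b, rfl⟩, ?_⟩
      induction y using bracket_ind with
      | bot =>
        refine ⟨bBot_lt_bMid _, ?_⟩
        induction z using bracket_ind with
        | bot => exact absurd hyz (lt_irrefl _)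
        | mid z => exact absurd rfl hz.label_ne
        | top => exact bMid_lt_bTop _
      | mid y => exact absurd rfl hy.label_ne
      | top => exact absurd hyz (isTop_bTop _).not_gt
    · intro a b' ha
      obtain ⟨rfl, rfl⟩ := eq_bMid ha
      exact ⟨_, _, isPredecessor_bBot, isSuccessor_bTop, isStateNode_bBot, isStateNode_bTop,
        State.records_update hb⟩
    · intro y v hv
      refine ⟨bTop _ _ _, trivial, fun z _ => isTop_bTop z, ?_⟩
      induction y using bracket_ind with
      | bot => exact .single (hstep v)
      | mid y => exact absurd rfl (isStateNode_of_mem_dom hv).label_ne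
      | top => rfl
    · intro y v hv
      induction y using bracket_ind with
      | bot => exact ⟨_, trivial, hv, .refl, Or.inl fun z _ => isBot_bBot z⟩
      | mid y => exact absurd rfl (isStateNode_of_mem_dom hv).label_ne
      | top =>
        by_cases hσ : v ∈ σ.dom
        · exact ⟨bBot _ _ _, trivial, hσ, .single (hstep v), Or.inl fun z _ => isBot_bBot z⟩
        · refine ⟨bTop _ _ _, trivial, hv, .refl,
            Or.inr ⟨bMid _ _ (), trivial, ?_, isSuccessor_bTop⟩⟩
          have hv : v ∈ (σ.update b).dom := hv
          obtain ⟨n, hn⟩ := State.mem_dom_iff.1 hv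
          cases b with
          | assign w k =>
            by_cases hw : v = w
            · subst hw
              exact Or.inl ⟨k, rfl⟩
            · exact absurd (State.mem_dom_iff.2 ⟨n, by simpa [State.update, hw] using hn⟩) hσ
          | copy w v' =>
            by_cases hw : v = w
            · subst hw
              exact Or.inr ⟨v', rfl⟩
            · exact absurd (State.mem_dom_iff.2 ⟨n, by simpa [State.update, hw] using hn⟩) hσ

/-! ### Finding an action and a border state -/

theorem Good.exists_act_bracket (h : (bracket σ x τ).Good) : ∃ z, x.IsActNode z := by
  obtain ⟨z, ⟨b, hb⟩, -⟩ := h.separated _ _ isStateNode_bBot isStateNode_bTop bBot_lt_bTop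
  obtain ⟨z, rfl⟩ := exists_bMid_of_label hb
  exact ⟨z, b, hb⟩

/-- At the border between two factors, one of the neighbouring nodes is a state-node that is
related to all nodes. -/
theorem Good.exists_isTop_or_isBot (h : (bracket σ (LPoset.seq p q) τ).Good)
    (hp : Nonempty p.carrier) (hq : Nonempty q.carrier) :
    (∃ m, IsTop m ∧ p.IsStateNode m) ∨ ∃ m, IsBot m ∧ q.IsStateNode m := by
  obtain ⟨x, hx⟩ : ∃ x : p.carrier, IsMax x := by
    obtain ⟨x, hx⟩ := Set.finite_univ.exists_maximal (Set.univ_nonempty (α := p.carrier))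
    exact ⟨x, fun y hy => hx.2 trivial hy⟩
  obtain ⟨y, hy⟩ : ∃ y : q.carrier, IsMin y := by
    obtain ⟨y, hy⟩ := Set.finite_univ.exists_minimal (Set.univ_nonempty (α := q.carrier))
    exact ⟨y, fun z hz => hy.2 trivial hz⟩
  rcases p.isStateNode_or_isActNode x with hx' | ⟨b, hx'⟩
  · rcases q.isStateNode_or_isActNode y with hy' | ⟨b, hy'⟩
    -- If both border nodes are states, A2 puts an action between them, which contradicts that `x`
    -- is maximal in `p` and `y` minimal in `q`.
    · obtain ⟨z, ⟨c, hz⟩, hxz, hzy⟩ := h.separated (bMid σ τ (seqL q x)) (bMid σ τ (seqR p y))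
        hx' hy' (bMid_lt_bMid.2 seqL_lt_seqR)
      obtain ⟨z, rfl⟩ := exists_bMid_of_label hz
      rw [bMid_lt_bMid] at hxz hzy
      induction z using seq_ind with
      | left z => exact absurd (seqL_lt_seqL.1 hxz) hx.not_lt
      | right z => exact absurd (seqR_lt_seqR.1 hzy) hy.not_lt
    -- All of `p` is below the action `y`, hence below its predecessor, which is not in `q` as `y`
    -- is minimal there: it is the greatest node of `p`.
    · obtain ⟨s, -, hs, -, hs', -, -⟩ := h.act (bMid σ τ (seqR p y)) b hy'
      obtain ⟨m⟩ := hp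
      have hle : ∀ z : p.carrier, bMid σ τ (seqL q z) ≤ s := fun z =>
        hs.2 _ (bMid_lt_bMid.2 seqL_lt_seqR)
      have hlt := hs.1
      induction s using bracket_ind with
      | bot => exact absurd (hle m) (bBot_lt_bMid _).not_ge
      | top => exact absurd hlt (isTop_bTop _).not_gt
      | mid s =>
        induction s using seq_ind with
        | left s => exact Or.inl ⟨s, fun z => seqL_le_seqL.1 (bMid_le_bMid.1 (hle z)), hs'⟩
        | right s => exact absurd (seqR_lt_seqR.1 (bMid_lt_bMid.1 hlt)) hy.not_lt
  · obtain ⟨-, s, -, hs, -, hs', -⟩ := h.act (bMid σ τ (seqL q x)) b hx'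
    obtain ⟨m⟩ := hq
    have hle : ∀ z : q.carrier, s ≤ bMid σ τ (seqR p z) := fun z =>
      hs.2 _ (bMid_lt_bMid.2 seqL_lt_seqR)
    have hlt := hs.1
    induction s using bracket_ind with
    | bot => exact absurd hlt (isBot_bBot _).not_gt
    | top => exact absurd (hle m) (bMid_lt_bTop _).not_ge
    | mid s =>
      induction s using seq_ind with
      | left s => exact absurd (seqL_lt_seqL.1 (bMid_lt_bMid.1 hlt)) hx.not_lt
      | right s => exact Or.inr ⟨s, fun z => seqR_le_seqR.1 (bMid_le_bMid.1 (hle z)), hs'⟩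

end LPoset

/-! ### The two directions and the main induction -/

namespace Pomset

open LPoset

variable {Var Val : Type*}

theorem Good.seq_iff {U V : Pomset (Letter Var Val)} {γ : State Var Val} :
    ((U.seq (ofState γ)).seq V).Good ↔ (U.seq (ofState γ)).Good ∧ ((ofState γ).seq V).Good := by
  obtain ⟨u, rfl⟩ := exists_mk U
  obtain ⟨v, rfl⟩ := exists_mk V
  constructor
  · intro h
    have h : (LPoset.seq (LPoset.seq u (single (Sum.inr γ))) v).Good := good_mk.1 h
    exact ⟨good_mk.2 h.left_of_seq, good_mk.2 h.right_of_seq⟩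
  · rintro ⟨h₁, h₂⟩
    have h₁ : (LPoset.seq u (single (Sum.inr γ))).Good := good_mk.1 h₁
    have h₂ : (LPoset.seq (single (Sum.inr γ)) v).Good := good_mk.1 h₂
    exact good_mk.2 (h₁.seq h₂)

theorem IsGuarded.good {U : Pomset (Letter Var Val)} (h : U.IsGuarded) : U.Good := by
  induction h with
  | state α => exact good_mk.2 (good_single α)
  | act α a h => exact good_mk.2 (good_bracket_single_iff.2 ⟨h, rfl⟩)
  | seq U V α _ _ ihU ihV => exact Good.seq_iff.2 ⟨ihU, ihV⟩
  | par U V α β γ δ _ _ h₁ h₂ ihU ihV =>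
    obtain ⟨u, rfl⟩ := exists_mk U
    obtain ⟨v, rfl⟩ := exists_mk V
    have hu : (bracket α u β).Good := good_mk.1 ihU
    have hv : (bracket γ v δ).Good := good_mk.1 ihV
    exact good_mk.2 (hu.par hv h₁ h₂)

/-- The end states are kept out of the measure and generalized: the parallel case replaces them by
smaller states, and the sequential case turns a border state of `X` into an end state of both
halves. -/
theorem isGuarded_of_good_bracket (n : ℕ) {X : Pomset (Letter Var Val)} (hX : X.IsSP)
    (hn : X.size ≤ n) {σ τ : State Var Val}
    (h : (((ofState σ).seq X).seq (ofState τ)).Good) :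
    (((ofState σ).seq X).seq (ofState τ)).IsGuarded := by
  induction n generalizing X σ τ with
  | zero =>
    obtain ⟨x, rfl⟩ := exists_mk X
    have h : (bracket σ x τ).Good := good_mk.1 h
    obtain ⟨z, -⟩ := h.exists_act_bracket
    have := size_pos (mk_ne_one.2 ⟨z⟩)
    omega
  | succ n ih =>
    rcases hX.cases_nonempty with rfl | ⟨l, rfl⟩ | ⟨P, Q, hP, hQ, hP1, hQ1, rfl⟩ |
      ⟨P, Q, hP, hQ, hP1, hQ1, rfl⟩
    · have h : (bracket σ (LPoset.empty _) τ).Good := good_mk.1 h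
      obtain ⟨z, -⟩ := h.exists_act_bracket
      exact z.elim
    · have h : (bracket σ (single l) τ).Good := good_mk.1 h
      obtain ⟨z, b, hb⟩ := h.exists_act_bracket
      obtain rfl : l = Sum.inl b := hb
      obtain ⟨h1, rfl⟩ := good_bracket_single_iff.1 h
      exact .act σ b h1
    · have sP := size_pos hP1
      have sQ := size_pos hQ1
      rw [size_par] at hn
      obtain ⟨p, rfl⟩ := exists_mk P
      obtain ⟨q, rfl⟩ := exists_mk Q
      have h : (bracket σ (LPoset.par p q) τ).Good := good_mk.1 h
      obtain ⟨α, β, γ, δ, h1, h2, h3, h4, rfl, rfl⟩ :=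
        h.exists_of_par (mk_ne_one.1 hP1) (mk_ne_one.1 hQ1)
      exact .par _ _ α β γ δ (ih hP (by omega) (good_mk.2 h1)) (ih hQ (by omega) (good_mk.2 h2))
        h3 h4
    · have sP := size_pos hP1
      have sQ := size_pos hQ1
      rw [size_seq] at hn
      -- Once the border state `ρ` is exposed, it serves as the last node of the left half and the
      -- first node of the right half. It may come from either factor, hence the common form.
      have split : ∀ (P Q : Pomset (Letter Var Val)) (ρ : State Var Val), P.IsSP → Q.IsSP →
          P.size ≤ n → Q.size ≤ n →
          ((((ofState σ).seq P).seq (ofState ρ)).seq (Q.seq (ofState τ))).Good →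
          ((((ofState σ).seq P).seq (ofState ρ)).seq (Q.seq (ofState τ))).IsGuarded := by
        intro P Q ρ hP hQ sP sQ h
        obtain ⟨h1, h2⟩ := Good.seq_iff.1 h
        rw [← seq_assoc] at h2
        refine .seq _ _ _ (ih hP sP h1) ?_
        rw [← seq_assoc]
        exact ih hQ sQ h2
      obtain ⟨p, rfl⟩ := exists_mk P
      obtain ⟨q, rfl⟩ := exists_mk Q
      have h' : (bracket σ (LPoset.seq p q) τ).Good := good_mk.1 h
      rcases h'.exists_isTop_or_isBot (mk_ne_one.1 hP1) (mk_ne_one.1 hQ1) with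
        ⟨m, hm, ρ, hρ⟩ | ⟨m, hm, ρ, hρ⟩
      · obtain ⟨V, hV, hPV⟩ := hP.exists_seq_atom rfl hm
        rw [hρ] at hPV
        have hs := congrArg size hPV
        rw [size_seq, size_atom] at hs
        have e : ((ofState σ).seq ((mk p).seq (mk q))).seq (ofState τ) =
            (((ofState σ).seq V).seq (ofState ρ)).seq ((mk q).seq (ofState τ)) := by
          rw [hPV]
          simp only [seq_assoc, ofState]
        rw [e] at h ⊢
        exact split V (mk q) ρ hV hQ (by omega) (by omega) h
      · obtain ⟨V, hV, hQV⟩ := hQ.exists_atom_seq rfl hm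
        rw [hρ] at hQV
        have hs := congrArg size hQV
        rw [size_seq, size_atom] at hs
        have e : ((ofState σ).seq ((mk p).seq (mk q))).seq (ofState τ) =
            (((ofState σ).seq (mk p)).seq (ofState ρ)).seq (V.seq (ofState τ)) := by
          rw [hQV]
          simp only [seq_assoc, ofState]
        rw [e] at h ⊢
        exact split (mk p) V ρ hP hV (by omega) (by omega) h

/-- The extremal nodes are states and can be split off. They coincide only for a one-node pomset;
otherwise the bracketed form of the induction appears. -/
theorem Good.isGuarded {U : Pomset (Letter Var Val)} (hU : U.IsSP) (h : U.Good) :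
    U.IsGuarded := by
  obtain ⟨u, rfl, hu⟩ := h
  obtain ⟨m, hm, σ, hσ⟩ := hu.bot
  obtain ⟨V, hV, e⟩ := hU.exists_atom_seq rfl hm
  rw [hσ] at e
  by_cases hV1 : V = Pomset.one _
  · rw [hV1, seq_one] at e
    rw [e]
    exact .state σ
  obtain ⟨v, rfl⟩ := exists_mk V
  have hu' : (LPoset.seq (single (Sum.inr σ)) v).Good := hu.of_iso (mk_eq.1 e)
  obtain ⟨t, ht, τ, hτ⟩ := hu'.top
  obtain ⟨y⟩ := mk_ne_one.1 hV1
  induction t using seq_ind with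
  | left t => exact absurd (ht (seqR _ y)) not_seqR_le_seqL
  | right t =>
    obtain ⟨W, hW, e'⟩ := hV.exists_seq_atom rfl (m := t) fun z => seqR_le_seqR.1 (ht (seqR _ z))
    rw [show v.label t = Sum.inr τ from hτ] at e'
    have e2 : mk u = ((ofState σ).seq W).seq (ofState τ) := by
      rw [e, e', seq_assoc]
      rfl
    rw [e2]
    exact isGuarded_of_good_bracket _ hW le_rfl (e2 ▸ good_mk.2 hu)

end Pomset

theorem mainTheorem4 {Var Val : Type*} [Finite Var] [Finite Val]
    (U : Pomset (Letter Var Val)) (hU : U.IsSP)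
    (u : LPoset (Letter Var Val)) (hu : U = Pomset.mk u) :
    U.IsGuarded ↔ u.A1 ∧ u.A2 ∧ u.A3 ∧ u.A4 ∧ u.A5 ∧ u.A6 ∧ u.A7 := by
  subst hu
  rw [← LPoset.good_iff, ← Pomset.good_mk]
  exact ⟨fun h => h.good, fun h => h.isGuarded hU⟩
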